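/- **Setting.** Spacetime is four-dimensional with coordinates $x^\mu$ and Minkowski metric $\eta=\mathrm{diag}(1,-1,-1,-1)$; let $\mathfrak g$ be a finite-dimensional real Lie algebra with basis $(e_a)$ and structure constants $[e_b,e_c]=f^a{}_{bc}e_a$, color indices being raised and lowered with $\delta_{ab}$. Let $\varkappa,\zeta,\xi,\alpha$ be nonzero real numbers and $\mathrm g$ a real number. The fields are the metric $g_{\mu\nu}=g_{\nu\mu}=\eta_{\mu\nu}+\alpha h_{\mu\nu}$ ($h$ the graviton), the graviton-ghost $C^\rho$, graviton-antighost $\overline C^\rho$ and auxiliary field $B^\rho$, the gauge field $A^a_\mu$, gauge ghost $c^a$, gauge antighost $\overline c^a$ and auxiliary field $b^a$, and finitely many further bosonic or fermionic components $\varphi^i$ that form tensor (density) fields in a representation of $\mathfrak g$. The ghosts, the antighosts and the fermionic $\varphi^i$ are odd and anticommute with each other; all other fields are even. Let $\mathcal A$ be the real supercommutative algebra of polynomials in all partial derivatives (of order $\ge 0$) of all these fields and in $1/\sqrt{-\det g}$; it contains $g^{\mu\nu}$ and $\sqrt{-\det g}$. Let $\partial_\mu$ be the total derivatives on $\mathcal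 A$, write $dV_\eta=dt\wedge dx\wedge dy\wedge dz$, $dV_g=\sqrt{-\det g}\,dV_\eta$, and identify a density $L\,dV_\eta$, $L\in\mathcal A$, with $L$. Write $\simeq$ for equality modulo total derivatives: $L\simeq L'$ iff $L-L'=\partial_\mu J^\mu$ for some $J^\mu\in\mathcal A$. **Operators.** $P,\overline P,Q,\overline Q$ are the odd derivations of $\mathcal A$ (acting from the left) that commute with all $\partial_\mu$ and are given on the fields as follows, with $\pounds$ the Lie derivative and $\varphi$ a further field. - $P g_{\mu\nu}=\varkappa\,(\pounds_C g)_{\mu\nu}=\varkappa\big(C^\rho\partial_\rho g_{\mu\nu}+(\partial_\mu C^\rho)g_{\rho\nu}+(\partial_\nu C^\rho)g_{\mu\rho}\big)$, $\;P C^\rho=\varkappa C^\sigma\partial_\sigma C^\rho$, $\;P\overline C^\rho=\tfrac1\zeta B^\rho$, $\;PB^\rho=0$, and $P\psi=\varkappa\pounds_C\psi$ for $\psi\in\{A_\mu^a,c^a,\overline c^a,b^a,\varphi\}$. - $\overline P g_{\mu\nu}=\varkappa(\pounds_{\overline C}g)_{\mu\nu}$, $\;\overline P C^\rho=-\tfrac1\zeta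 B^\rho+\varkappa\big(\overline C^\sigma\partial_\sigma C^\rho-(\partial_\sigma\overline C^\rho)C^\sigma\big)$, $\;\overline P\,\overline C^\rho=\varkappa\overline C^\sigma\partial_\sigma\overline C^\rho$, $\;\overline P B^\rho=\varkappa\big(\overline C^\sigma\partial_\sigma B^\rho-(\partial_\sigma\overline C^\rho)B^\sigma\big)$, and $\overline P\psi=\varkappa\pounds_{\overline C}\psi$ for $\psi\in\{A_\mu^a,c^a,\overline c^a,b^a,\varphi\}$. - $Q A^a_\mu=\tfrac1\xi\partial_\mu c^a+\mathrm g f^a{}_{bc}c^bA^c_\mu$, $\;Qc^a=\tfrac{\mathrm g}2f^a{}_{bc}c^bc^c$, $\;Q\overline c^a=\tfrac1\xi b^a$, $\;Qb^a=0$, $\;Q\varphi=\mathrm g\,c^a(e_a\cdot\varphi)$, and $Q$ vanishes on $g_{\mu\nu},C^\rho,\overline C^\rho,B^\rho$. - $\overline Q A^a_\mu=\tfrac1\xi\partial_\mu\overline c^a+\mathrm g f^a{}_{bc}\overline c^bA^c_\mu$, $\;\overline Qc^a=-\tfrac1\xi b^a+\mathrm g f^a{}_{bc}\overline c^bc^c$,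 $\;\overline Q\,\overline c^a=\tfrac{\mathrm g}2f^a{}_{bc}\overline c^b\overline c^c$, $\;\overline Qb^a=\mathrm g f^a{}_{bc}\overline c^bb^c$, $\;\overline Q\varphi=\mathrm g\,\overline c^a(e_a\cdot\varphi)$, and $\overline Q$ vanishes on $g_{\mu\nu},C^\rho,\overline C^\rho,B^\rho$. Put $D=P+Q$, $\overline D=\overline P+\overline Q$, $\mathcal P=P\circ\overline P$, $\mathcal Q=Q\circ\overline Q$, $\mathcal D=D\circ\overline D$. The gauge fixing bosons are $$F=-\frac\zeta4\Big(\frac1\varkappa\eta^{\mu\nu}h_{\mu\nu}-\overline C^\rho\eta_{\rho\sigma}C^\sigma\Big)dV_\eta,\qquad G=-\frac\xi2\Big(\delta_{ab}g^{\mu\nu}A^a_\mu A^b_\nu-\overline c_ac^a\Big)dV_g,\qquad B=F+G,$$ and the symmetric gauge fixing and ghost Lagrange densities (auxiliary fields included) are $\mathcal L_{\mathrm{GR\text{-}GF\text{-}Ghost}}=\mathcal PF$ and $\mathcal L_{\mathrm{YM\text{-}GF\text{-}Ghost}}=\mathcal QG$. **Theorem.** The total super-BRST operator generates the complete gauge fixing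 and ghost Lagrange density from the total gauge fixing boson: $$\mathcal L_{\mathrm{GR\text{-}GF\text{-}Ghost}}+\mathcal L_{\mathrm{YM\text{-}GF\text{-}Ghost}}\;\simeq\;\mathcal D B .$$ -/

import Mathlib

open scoped TensorProduct

namespace BRST

noncomputable section

/-! ### Field content

Spacetime has four dimensions; Lorentz indices are elements of `Fin 4`.  Color indices are elements
of `ι`, the components of the other bosonic (fermionic) particle fields are indexed by `I₀` (`I₁`).
-/

/-- Components of the even fields: metric `g_{μν}` (one for each unordered pair of indices), graviton
auxiliary field `B^ρ`, gauge field `A^a_μ`, gauge auxiliary field `b^a`, other even fields. -/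
inductive EvenField (ι I₀ : Type*)
  | metric (p : Sym2 (Fin 4))
  | auxB (ρ : Fin 4)
  | gauge (a : ι) (μ : Fin 4)
  | auxb (a : ι)
  | matter (i : I₀)

/-- Components of the odd fields: graviton-ghost `C^ρ`, graviton-antighost `C̄^ρ`, gauge ghost `c^a`,
gauge antighost `c̄^a`, other odd fields. -/
inductive OddField (ι I₁ : Type*)
  | ghostC (ρ : Fin 4)
  | antighostC (ρ : Fin 4)
  | ghostc (a : ι)
  | antighostc (a : ι)
  | matter (i : I₁)

/-- A multi-index `J`, standing for the iterated derivative `∂^J`. -/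
abbrev MultiIndex : Type := Fin 4 → ℕ

/-- Jet coordinates `∂^J u` of the even fields. -/
abbrev EvenJet (ι I₀ : Type*) := EvenField ι I₀ × MultiIndex

/-- Jet coordinates `∂^J θ` of the odd fields. -/
abbrev OddJet (ι I₁ : Type*) := OddField ι I₁ × MultiIndex

/-! ### The even part of the algebra of local functions

Polynomials in the even jet coordinates and in one more variable `w = 1 / √(-det g)`, that is, modulo
the single relation `w² det g = -1`.  Both `√(-det g)` and the inverse metric live in this ring. -/

/-- Polynomials in the even jet coordinates (`some z`) and in `w` (`none`). -/
abbrev PreEven (ι I₀ : Type*) := MvPolynomial (Option (EvenJet ι I₀)) ℝ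

/-- The polynomial `det g`. -/
def preDet (ι I₀ : Type*) : PreEven ι I₀ :=
  (Matrix.of fun μ ν : Fin 4 =>
    (MvPolynomial.X (some (EvenField.metric s(μ, ν), 0)) : PreEven ι I₀)).det

/-- The ideal of the relation `w² det g + 1 = 0`. -/
def volumeIdeal (ι I₀ : Type*) : Ideal (PreEven ι I₀) :=
  Ideal.span {MvPolynomial.X none ^ 2 * preDet ι I₀ + 1}

/-- The commutative ring of local functions of the even fields. -/
def EvenAlg (ι I₀ : Type*) := PreEven ι I₀ ⧸ volumeIdeal ι I₀

instance (ι I₀ : Type*) : CommRing (EvenAlg ι I₀) :=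
  inferInstanceAs (CommRing (PreEven ι I₀ ⧸ volumeIdeal ι I₀))

instance (ι I₀ : Type*) : Algebra ℝ (EvenAlg ι I₀) :=
  inferInstanceAs (Algebra ℝ (PreEven ι I₀ ⧸ volumeIdeal ι I₀))

/-- The projection from the polynomials. -/
def toEvenAlg (ι I₀ : Type*) : PreEven ι I₀ →ₐ[ℝ] EvenAlg ι I₀ :=
  Ideal.Quotient.mkₐ ℝ (volumeIdeal ι I₀)

lemma toEvenAlg_surjective (ι I₀ : Type*) : Function.Surjective (toEvenAlg ι I₀) :=
  Ideal.Quotient.mkₐ_surjective ℝ _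

lemma toEvenAlg_eq_zero_iff {ι I₀ : Type*} (x : PreEven ι I₀) :
    toEvenAlg ι I₀ x = 0 ↔ x ∈ volumeIdeal ι I₀ :=
  Ideal.Quotient.eq_zero_iff_mem

/-- The derivative with respect to the jet coordinate `z` before passing to the quotient: by the chain
rule, `∂w/∂z = ½ w³ ∂(det g)/∂z`. -/
def preEvenPartial {ι I₀ : Type*} (z : EvenJet ι I₀) :
    Derivation ℝ (PreEven ι I₀) (PreEven ι I₀) :=
  MvPolynomial.pderiv (some z) +
    (MvPolynomial.C (1 / 2) * MvPolynomial.X none ^ 3 *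
      MvPolynomial.pderiv (some z) (preDet ι I₀)) • MvPolynomial.pderiv none

lemma pderiv_none_preDet (ι I₀ : Type*) :
    MvPolynomial.pderiv none (preDet ι I₀) = 0 := by
  classical
  unfold preDet
  rw [Matrix.det_apply, map_sum]
  refine Finset.sum_eq_zero fun σ _ => ?_
  rw [Units.smul_def, map_zsmul]
  simp [Fin.prod_univ_four, Derivation.leibniz, MvPolynomial.pderiv_X]

lemma preEvenPartial_mem {ι I₀ : Type*} (z : EvenJet ι I₀) (x : PreEven ι I₀)
    (hx : toEvenAlg ι I₀ x = 0) : toEvenAlg ι I₀ (preEvenPartial z x) = 0 := by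
  classical
  have key : preEvenPartial z (MvPolynomial.X none ^ 2 * preDet ι I₀ + 1) =
      (MvPolynomial.X none ^ 2 * preDet ι I₀ + 1) *
        (MvPolynomial.X none ^ 2 * MvPolynomial.pderiv (some z) (preDet ι I₀)) := by
    have h2 : (MvPolynomial.C (1 / 2) : PreEven ι I₀) * 2 = 1 := by
      rw [show (2 : PreEven ι I₀) = MvPolynomial.C 2 from (map_ofNat MvPolynomial.C 2).symm,
        ← MvPolynomial.C_mul]
      norm_num
    simp only [preEvenPartial, map_add, Derivation.add_apply, Derivation.smul_apply,
      Derivation.leibniz, Derivation.leibniz_pow, pderiv_none_preDet, MvPolynomial.pderiv_X,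
      Derivation.map_one_eq_zero, smul_eq_mul, nsmul_eq_mul]
    simp only [Pi.single_apply]
    simp only [reduceCtorEq, if_false, if_true]
    linear_combination (preDet ι I₀ * MvPolynomial.pderiv (some z) (preDet ι I₀) *
      MvPolynomial.X none ^ 4) * h2
  rw [toEvenAlg_eq_zero_iff, volumeIdeal, Ideal.mem_span_singleton'] at *
  obtain ⟨a, rfl⟩ := hx
  rw [Derivation.leibniz, key, smul_eq_mul, smul_eq_mul]
  exact ⟨a * (MvPolynomial.X none ^ 2 * MvPolynomial.pderiv (some z) (preDet ι I₀)) +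
    preEvenPartial z a, by ring⟩

/-- The partial derivative `∂/∂z` on local functions of the even fields. -/
def evenAlgPartial {ι I₀ : Type*} (z : EvenJet ι I₀) :
    Derivation ℝ (EvenAlg ι I₀) (EvenAlg ι I₀) :=
  Derivation.liftOfSurjective (toEvenAlg_surjective ι I₀) (d := preEvenPartial z)
    (preEvenPartial_mem z)

/-- The metric as a matrix over the ring of even local functions. -/
def metricMatrix (ι I₀ : Type*) : Matrix (Fin 4) (Fin 4) (EvenAlg ι I₀) :=
  Matrix.of fun μ ν => toEvenAlg ι I₀ (MvPolynomial.X (some (EvenField.metric s(μ, ν), 0)))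

/-- `√(-det g) = -w det g`. -/
def sqrtNegDet (ι I₀ : Type*) : EvenAlg ι I₀ :=
  -(toEvenAlg ι I₀ (MvPolynomial.X none) * (metricMatrix ι I₀).det)

lemma det_metricMatrix (ι I₀ : Type*) :
    toEvenAlg ι I₀ (MvPolynomial.X none) ^ 2 * (metricMatrix ι I₀).det
      = -1 := by
  have h : (metricMatrix ι I₀).det = toEvenAlg ι I₀ (preDet ι I₀) := by
    rw [preDet, AlgHom.map_det]; rfl
  have h' : toEvenAlg ι I₀ (MvPolynomial.X none ^ 2 * preDet ι I₀ + 1) = 0 :=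
    (toEvenAlg_eq_zero_iff _).2 (Ideal.subset_span rfl)
  rw [h, ← map_pow, ← map_mul, eq_neg_iff_add_eq_zero, ← map_one (toEvenAlg ι I₀), ← map_add,
    h']

/-- The metric is invertible, so `(metricMatrix ι I₀)⁻¹` is the true inverse metric. -/
lemma isUnit_det_metricMatrix (ι I₀ : Type*) : IsUnit (metricMatrix ι I₀).det :=
  IsUnit.of_mul_eq_one (-(toEvenAlg ι I₀ (MvPolynomial.X none) ^ 2)) (by
    linear_combination -det_metricMatrix ι I₀)

lemma sqrtNegDet_sq (ι I₀ : Type*) : sqrtNegDet ι I₀ ^ 2 = -(metricMatrix ι I₀).det := by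
  unfold sqrtNegDet
  linear_combination (metricMatrix ι I₀).det * det_metricMatrix ι I₀

/-! ### The superalgebra of local functions and its vector fields -/

/-- Local functions: the even ones tensored with the Grassmann algebra on the odd jet coordinates.
Odd coordinates of all kinds anticommute with each other. -/
def LocalAlg (ι I₀ I₁ : Type*) := EvenAlg ι I₀ ⊗[ℝ] ExteriorAlgebra ℝ (OddJet ι I₁ →₀ ℝ)

instance (ι I₀ I₁ : Type*) : Ring (LocalAlg ι I₀ I₁) :=
  inferInstanceAs (Ring (EvenAlg ι I₀ ⊗[ℝ] ExteriorAlgebra ℝ (OddJet ι I₁ →₀ ℝ)))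

instance (ι I₀ I₁ : Type*) : Algebra ℝ (LocalAlg ι I₀ I₁) :=
  inferInstanceAs (Algebra ℝ (EvenAlg ι I₀ ⊗[ℝ] ExteriorAlgebra ℝ (OddJet ι I₁ →₀ ℝ)))

section Fields

variable {ι I₀ I₁ : Type*}

/-- The inclusion of the even local functions. -/
def ofEven : EvenAlg ι I₀ →ₐ[ℝ] LocalAlg ι I₀ I₁ :=
  (Algebra.TensorProduct.includeLeft :
    EvenAlg ι I₀ →ₐ[ℝ] EvenAlg ι I₀ ⊗[ℝ] ExteriorAlgebra ℝ (OddJet ι I₁ →₀ ℝ))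

/-- The inclusion of the Grassmann algebra. -/
def ofOdd : ExteriorAlgebra ℝ (OddJet ι I₁ →₀ ℝ) →ₐ[ℝ] LocalAlg ι I₀ I₁ :=
  (Algebra.TensorProduct.includeRight : ExteriorAlgebra ℝ (OddJet ι I₁ →₀ ℝ) →ₐ[ℝ]
    EvenAlg ι I₀ ⊗[ℝ] ExteriorAlgebra ℝ (OddJet ι I₁ →₀ ℝ))

/-- The jet coordinate `∂^J u` of an even field. -/
def evenCoord (z : EvenJet ι I₀) : LocalAlg ι I₀ I₁ :=
  ofEven (toEvenAlg ι I₀ (MvPolynomial.X (some z)))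

/-- The jet coordinate `∂^J θ` of an odd field. -/
def oddCoord (z : OddJet ι I₁) : LocalAlg ι I₀ I₁ :=
  ofOdd (ExteriorAlgebra.ι ℝ (Finsupp.single z 1))

/-- `∂/∂z` for an even jet coordinate. -/
def evenPartial (z : EvenJet ι I₀) : LocalAlg ι I₀ I₁ →ₗ[ℝ] LocalAlg ι I₀ I₁ :=
  TensorProduct.map (evenAlgPartial z : EvenAlg ι I₀ →ₗ[ℝ] EvenAlg ι I₀) LinearMap.id

/-- The left derivative `∂/∂z` for an odd jet coordinate. -/
def oddPartial (z : OddJet ι I₁) : LocalAlg ι I₀ I₁ →ₗ[ℝ] LocalAlg ι I₀ I₁ :=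
  TensorProduct.map LinearMap.id (CliffordAlgebra.contractLeft (Finsupp.lapply z))

/-- The vector field `∑_z V_z ∂/∂z + ∑_z W_z ∂/∂z` with the sums running over the even and over the
odd jet coordinates.  Every local function involves finitely many coordinates, so on each of them
the sums are finite. -/
def vectorField (V : EvenJet ι I₀ → LocalAlg ι I₀ I₁) (W : OddJet ι I₁ → LocalAlg ι I₀ I₁)
    (X : LocalAlg ι I₀ I₁) : LocalAlg ι I₀ I₁ :=
  (∑ᶠ z, V z * evenPartial z X) + ∑ᶠ z, W z * oddPartial z X

/-- The total derivative `∂_μ`. -/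
def totalD (μ : Fin 4) : LocalAlg ι I₀ I₁ → LocalAlg ι I₀ I₁ :=
  vectorField (fun z => evenCoord (z.1, z.2 + Pi.single μ 1))
    (fun z => oddCoord (z.1, z.2 + Pi.single μ 1))

/-- The iterated total derivative `∂^J`. -/
def iterD (J : MultiIndex) (X : LocalAlg ι I₀ I₁) : LocalAlg ι I₀ I₁ :=
  (totalD 0)^[J 0] ((totalD 1)^[J 1] ((totalD 2)^[J 2] ((totalD 3)^[J 3] X)))

/-- The vector field on the jets with prescribed values `p u` and `q θ` on the fields, prolonged by
`∂^J u ↦ ∂^J (p u)` and `∂^J θ ↦ ∂^J (q θ)`. -/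
def prolong (p : EvenField ι I₀ → LocalAlg ι I₀ I₁) (q : OddField ι I₁ → LocalAlg ι I₀ I₁) :
    LocalAlg ι I₀ I₁ → LocalAlg ι I₀ I₁ :=
  vectorField (fun z => iterD z.2 (p z.1)) (fun z => iterD z.2 (q z.1))

/-- Equality of Lagrange densities modulo total derivatives.  A density is represented by its
coefficient with respect to `dt ∧ dx ∧ dy ∧ dz`. -/
def EqModTD (X Y : LocalAlg ι I₀ I₁) : Prop :=
  ∃ J : Fin 4 → LocalAlg ι I₀ I₁, X - Y = ∑ μ, totalD μ (J μ)

/-! ### The fields as local functions -/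

/-- The metric `g_{μν}`. -/
def met (μ ν : Fin 4) : LocalAlg ι I₀ I₁ := evenCoord (.metric s(μ, ν), 0)

/-- The inverse metric `g^{μν}`. -/
def metInv (μ ν : Fin 4) : LocalAlg ι I₀ I₁ := ofEven ((metricMatrix ι I₀)⁻¹ μ ν)

/-- The coefficient `√(-det g)` of the Riemannian volume form `dV_g`. -/
def volg : LocalAlg ι I₀ I₁ := ofEven (sqrtNegDet ι I₀)

def fieldB (ρ : Fin 4) : LocalAlg ι I₀ I₁ := evenCoord (.auxB ρ, 0)

def fieldA (a : ι) (μ : Fin 4) : LocalAlg ι I₀ I₁ := evenCoord (.gauge a μ, 0)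

def fieldb (a : ι) : LocalAlg ι I₀ I₁ := evenCoord (.auxb a, 0)

def fieldC (ρ : Fin 4) : LocalAlg ι I₀ I₁ := oddCoord (.ghostC ρ, 0)

def fieldCbar (ρ : Fin 4) : LocalAlg ι I₀ I₁ := oddCoord (.antighostC ρ, 0)

def fieldc (a : ι) : LocalAlg ι I₀ I₁ := oddCoord (.ghostc a, 0)

def fieldcbar (a : ι) : LocalAlg ι I₀ I₁ := oddCoord (.antighostc a, 0)

def evenMatter (i : I₀) : LocalAlg ι I₀ I₁ := evenCoord (.matter i, 0)

def oddMatter (i : I₁) : LocalAlg ι I₀ I₁ := oddCoord (.matter i, 0)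

/-- The Minkowski metric `η = diag(1, -1, -1, -1)`, equal to its inverse. -/
def eta (μ ν : Fin 4) : ℝ := if μ = ν then (if μ = 0 then 1 else -1) else 0

/-- The graviton field `h_{μν}` of the decomposition `g_{μν} = η_{μν} + α h_{μν}`.  Since
`P g_{μν} = ϰ (∇_μ C_ν + ∇_ν C_μ)`, one has `P h_{μν} = (ϰ/α) (∇_μ C_ν + ∇_ν C_μ)`; the choice `α = ϰ`
is the usual decomposition and `α = ϰ ζ` gives `P h_{μν} = (1/ζ) (∇_μ C_ν + ∇_ν C_μ)`. -/
def graviton (α : ℝ) (μ ν : Fin 4) : LocalAlg ι I₀ I₁ :=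
  (1 / α) • (met μ ν - algebraMap ℝ _ (eta μ ν))

/-! ### Lie derivatives with respect to an (odd) vector field `K^ρ` on spacetime -/

/-- `£_K` of a scalar. -/
def lieScalar (K : Fin 4 → LocalAlg ι I₀ I₁) (φ : LocalAlg ι I₀ I₁) : LocalAlg ι I₀ I₁ :=
  ∑ ρ, K ρ * totalD ρ φ

/-- `£_K` of a covector. -/
def lieCovector (K : Fin 4 → LocalAlg ι I₀ I₁) (A : Fin 4 → LocalAlg ι I₀ I₁) (μ : Fin 4) :
    LocalAlg ι I₀ I₁ :=
  ∑ ρ, (K ρ * totalD ρ (A μ) + totalD μ (K ρ) * A ρ)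

/-- `(£_K g)_{μν} = K^ρ ∂_ρ g_{μν} + (∂_μ K^ρ) g_{ρν} + (∂_ν K^ρ) g_{μρ}`, the coordinate form of
`∇_μ K_ν + ∇_ν K_μ`. -/
def lieMetric (K : Fin 4 → LocalAlg ι I₀ I₁) (μ ν : Fin 4) : LocalAlg ι I₀ I₁ :=
  ∑ ρ, (K ρ * totalD ρ (met μ ν) + totalD μ (K ρ) * met ρ ν + totalD ν (K ρ) * met μ ρ)

lemma lieMetric_comm (K : Fin 4 → LocalAlg ι I₀ I₁) (μ ν : Fin 4) :
    lieMetric K μ ν = lieMetric K ν μ := by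
  have h : ∀ μ ν : Fin 4, (met μ ν : LocalAlg ι I₀ I₁) = met ν μ := fun μ ν => by
    simp [met, Sym2.eq_swap]
  unfold lieMetric
  refine Finset.sum_congr rfl fun ρ _ => ?_
  rw [h μ ν, h ρ ν, h μ ρ, add_right_comm]

/-- `£_K g` as a function of the unordered pair of indices. -/
def lieMetricSym (K : Fin 4 → LocalAlg ι I₀ I₁) (p : Sym2 (Fin 4)) : LocalAlg ι I₀ I₁ :=
  Sym2.lift ⟨lieMetric K, lieMetric_comm K⟩ p

end Fields

/-- The way in which the components `φ^i` of the other particle fields transform: a representation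
of `gl(4)`, which says what kind of tensor (density) they form, and a commuting representation of the
gauge Lie algebra. -/
structure Multiplet (𝔤 I : Type*) [LieRing 𝔤] [LieAlgebra ℝ 𝔤] [Fintype I] where
  tensor : Matrix (Fin 4) (Fin 4) ℝ →ₗ[ℝ] Matrix I I ℝ
  tensor_lie : ∀ X Y, tensor (X * Y - Y * X) = tensor X * tensor Y - tensor Y * tensor X
  charge : 𝔤 →ₗ[ℝ] Matrix I I ℝ
  charge_lie : ∀ x y, charge ⁅x, y⁆ = charge x * charge y - charge y * charge x
  comm : ∀ X y, Commute (tensor X) (charge y)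

section Operators

variable {𝔤 ι I₀ I₁ : Type*} [LieRing 𝔤] [LieAlgebra ℝ 𝔤]
  [Fintype ι] [Fintype I₀] [Fintype I₁]

/-- `(£_K φ)^i = K^ρ ∂_ρ φ^i - (∂_ν K^μ) (E_{μν})^i_j φ^j`, where `E_{μν}` is the elementary matrix;
for vectors (`tensor X = X`) and covectors (`tensor X = -Xᵀ`) these are the usual formulas. -/
def lieMatter {I : Type*} [Fintype I] (M : Multiplet 𝔤 I)
    (K : Fin 4 → LocalAlg ι I₀ I₁) (φ : I → LocalAlg ι I₀ I₁) (i : I) : LocalAlg ι I₀ I₁ :=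
  lieScalar K (φ i) -
    ∑ μ, ∑ ν, ∑ j, M.tensor (Matrix.single μ ν 1) i j • (totalD ν (K μ) * φ j)

/-- `(ℓ_k φ)^i = k^a (e_a)^i_j φ^j`, the infinitesimal gauge transformation. -/
def gaugeMatter {I : Type*} [Fintype I] (M : Multiplet 𝔤 I)
    (e : Module.Basis ι ℝ 𝔤) (k : ι → LocalAlg ι I₀ I₁) (φ : I → LocalAlg ι I₀ I₁) (i : I) :
    LocalAlg ι I₀ I₁ :=
  ∑ a, ∑ j, M.charge (e a) i j • (k a * φ j)

/-- The structure constants: `[e_b, e_c] = f^a_{bc} e_a`. -/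
def structConst (e : Module.Basis ι ℝ 𝔤) (a b c : ι) : ℝ := e.repr ⁅e b, e c⁆ a

/-- `f^a_{bc} x^b y^c`. -/
def colorBracket (e : Module.Basis ι ℝ 𝔤) (x y : ι → LocalAlg ι I₀ I₁) (a : ι) :
    LocalAlg ι I₀ I₁ :=
  ∑ b, ∑ c, structConst e a b c • (x b * y c)

/-- The diffeomorphism BRST operator `P`. -/
def opP (ϰ ζ : ℝ) (M₀ : Multiplet 𝔤 I₀) (M₁ : Multiplet 𝔤 I₁) :
    LocalAlg ι I₀ I₁ → LocalAlg ι I₀ I₁ :=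
  prolong
    (fun u => match u with
      | .metric p => ϰ • lieMetricSym fieldC p
      | .auxB _ => 0
      | .gauge a μ => ϰ • lieCovector fieldC (fieldA a) μ
      | .auxb a => ϰ • lieScalar fieldC (fieldb a)
      | .matter i => ϰ • lieMatter M₀ fieldC evenMatter i)
    (fun θ => match θ with
      | .ghostC ρ => ϰ • ∑ σ, fieldC σ * totalD σ (fieldC ρ)
      | .antighostC ρ => (1 / ζ) • fieldB ρ
      | .ghostc a => ϰ • lieScalar fieldC (fieldc a)
      | .antighostc a => ϰ • lieScalar fieldC (fieldcbar a)
      | .matter i => ϰ • lieMatter M₁ fieldC oddMatter i)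

/-- The diffeomorphism anti-BRST operator `P̄`. -/
def opPbar (ϰ ζ : ℝ) (M₀ : Multiplet 𝔤 I₀) (M₁ : Multiplet 𝔤 I₁) :
    LocalAlg ι I₀ I₁ → LocalAlg ι I₀ I₁ :=
  prolong
    (fun u => match u with
      | .metric p => ϰ • lieMetricSym fieldCbar p
      | .auxB ρ => ϰ • ∑ σ, (fieldCbar σ * totalD σ (fieldB ρ) -
          totalD σ (fieldCbar ρ) * fieldB σ)
      | .gauge a μ => ϰ • lieCovector fieldCbar (fieldA a) μ
      | .auxb a => ϰ • lieScalar fieldCbar (fieldb a)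
      | .matter i => ϰ • lieMatter M₀ fieldCbar evenMatter i)
    (fun θ => match θ with
      | .ghostC ρ => -((1 / ζ) • fieldB ρ) +
          ϰ • ∑ σ, (fieldCbar σ * totalD σ (fieldC ρ) - totalD σ (fieldCbar ρ) * fieldC σ)
      | .antighostC ρ => ϰ • ∑ σ, fieldCbar σ * totalD σ (fieldCbar ρ)
      | .ghostc a => ϰ • lieScalar fieldCbar (fieldc a)
      | .antighostc a => ϰ • lieScalar fieldCbar (fieldcbar a)
      | .matter i => ϰ • lieMatter M₁ fieldCbar oddMatter i)

/-- The gauge BRST operator `Q`; `γ` is the gauge coupling constant.  The gravitational fields are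
gauge singlets. -/
def opQ (γ ξ : ℝ) (e : Module.Basis ι ℝ 𝔤) (M₀ : Multiplet 𝔤 I₀) (M₁ : Multiplet 𝔤 I₁) :
    LocalAlg ι I₀ I₁ → LocalAlg ι I₀ I₁ :=
  prolong
    (fun u => match u with
      | .metric _ => 0
      | .auxB _ => 0
      | .gauge a μ => (1 / ξ) • totalD μ (fieldc a) +
          γ • colorBracket e fieldc (fun c => fieldA c μ) a
      | .auxb _ => 0
      | .matter i => γ • gaugeMatter M₀ e fieldc evenMatter i)
    (fun θ => match θ with
      | .ghostC _ => 0
      | .antighostC _ => 0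
      | .ghostc a => (γ / 2) • colorBracket e fieldc fieldc a
      | .antighostc a => (1 / ξ) • fieldb a
      | .matter i => γ • gaugeMatter M₁ e fieldc oddMatter i)

/-- The gauge anti-BRST operator `Q̄`. -/
def opQbar (γ ξ : ℝ) (e : Module.Basis ι ℝ 𝔤) (M₀ : Multiplet 𝔤 I₀) (M₁ : Multiplet 𝔤 I₁) :
    LocalAlg ι I₀ I₁ → LocalAlg ι I₀ I₁ :=
  prolong
    (fun u => match u with
      | .metric _ => 0
      | .auxB _ => 0
      | .gauge a μ => (1 / ξ) • totalD μ (fieldcbar a) +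
          γ • colorBracket e fieldcbar (fun c => fieldA c μ) a
      | .auxb a => γ • colorBracket e fieldcbar fieldb a
      | .matter i => γ • gaugeMatter M₀ e fieldcbar evenMatter i)
    (fun θ => match θ with
      | .ghostC _ => 0
      | .antighostC _ => 0
      | .ghostc a => -((1 / ξ) • fieldb a) + γ • colorBracket e fieldcbar fieldc a
      | .antighostc a => (γ / 2) • colorBracket e fieldcbar fieldcbar a
      | .matter i => γ • gaugeMatter M₁ e fieldcbar oddMatter i)

/-- The total BRST operator `D = P + Q`. -/
def opD (ϰ ζ γ ξ : ℝ) (e : Module.Basis ι ℝ 𝔤) (M₀ : Multiplet 𝔤 I₀) (M₁ : Multiplet 𝔤 I₁) :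
    LocalAlg ι I₀ I₁ → LocalAlg ι I₀ I₁ :=
  opP ϰ ζ M₀ M₁ + opQ γ ξ e M₀ M₁

/-- The total anti-BRST operator `D̄ = P̄ + Q̄`. -/
def opDbar (ϰ ζ γ ξ : ℝ) (e : Module.Basis ι ℝ 𝔤) (M₀ : Multiplet 𝔤 I₀) (M₁ : Multiplet 𝔤 I₁) :
    LocalAlg ι I₀ I₁ → LocalAlg ι I₀ I₁ :=
  opPbar ϰ ζ M₀ M₁ + opQbar γ ξ e M₀ M₁

/-- The diffeomorphism super-BRST operator `P ∘ P̄`. -/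
def superP (ϰ ζ : ℝ) (M₀ : Multiplet 𝔤 I₀) (M₁ : Multiplet 𝔤 I₁) :
    LocalAlg ι I₀ I₁ → LocalAlg ι I₀ I₁ :=
  opP ϰ ζ M₀ M₁ ∘ opPbar ϰ ζ M₀ M₁

/-- The gauge super-BRST operator `Q ∘ Q̄`. -/
def superQ (γ ξ : ℝ) (e : Module.Basis ι ℝ 𝔤) (M₀ : Multiplet 𝔤 I₀) (M₁ : Multiplet 𝔤 I₁) :
    LocalAlg ι I₀ I₁ → LocalAlg ι I₀ I₁ :=
  opQ γ ξ e M₀ M₁ ∘ opQbar γ ξ e M₀ M₁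

/-- The total super-BRST operator `D ∘ D̄`. -/
def superD (ϰ ζ γ ξ : ℝ) (e : Module.Basis ι ℝ 𝔤) (M₀ : Multiplet 𝔤 I₀) (M₁ : Multiplet 𝔤 I₁) :
    LocalAlg ι I₀ I₁ → LocalAlg ι I₀ I₁ :=
  opD ϰ ζ γ ξ e M₀ M₁ ∘ opDbar ϰ ζ γ ξ e M₀ M₁

/-- The gravitational gauge fixing boson
`F = -ζ/4 ((1/ϰ) η^{μν} h_{μν} - C̄^ρ C_ρ) dV_η`, with `C_ρ = η_{ρσ} C^σ`. -/
def bosonF (ϰ ζ α : ℝ) : LocalAlg ι I₀ I₁ :=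
  (-(ζ / 4)) • ((1 / ϰ) • ∑ μ, ∑ ν, eta μ ν • graviton α μ ν -
    ∑ ρ, fieldCbar ρ * ∑ σ, eta ρ σ • fieldC σ)

/-- The Yang–Mills gauge fixing boson `G = -ξ/2 (δ_{ab} g^{μν} A^a_μ A^b_ν - c̄_a c^a) dV_g`. -/
def bosonG (ξ : ℝ) : LocalAlg ι I₀ I₁ :=
  (-(ξ / 2)) • ((∑ a, ∑ μ, ∑ ν, metInv μ ν * fieldA a μ * fieldA a ν -
    ∑ a, fieldcbar a * fieldc a) * volg)

/-- The total gauge fixing boson `B = F + G`. -/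
def bosonB (ϰ ζ ξ α : ℝ) : LocalAlg ι I₀ I₁ := bosonF ϰ ζ α + bosonG ξ

/-- The gauge fixing and ghost Lagrange density of gravity. -/
def grGFGhost (ϰ ζ α : ℝ) (M₀ : Multiplet 𝔤 I₀) (M₁ : Multiplet 𝔤 I₁) : LocalAlg ι I₀ I₁ :=
  superP ϰ ζ M₀ M₁ (bosonF ϰ ζ α)

/-- The gauge fixing and ghost Lagrange density of Yang–Mills theory. -/
def ymGFGhost (γ ξ : ℝ) (e : Module.Basis ι ℝ 𝔤) (M₀ : Multiplet 𝔤 I₀) (M₁ : Multiplet 𝔤 I₁) :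
    LocalAlg ι I₀ I₁ :=
  superQ γ ξ e M₀ M₁ (bosonG ξ)

end Operators

end

end BRST

open scoped TensorProduct

/-! ### Derivations of determinants and inverse matrices -/

namespace Derivation

variable {R A M n : Type*} [CommRing R] [CommRing A] [Algebra R A] [AddCommGroup M] [Module A M]
  [Module R M]

/-! Expanding $(P+Q)(\overline P+\overline Q)(F+G)$ gives the two wanted terms $P\overline PF$ and
$Q\overline QG$ plus six mixed ones. Three vanish: $F$ contains only fields on which $\overline Q$
is zero (`opQbar_bosonF`), and $\overline PF$ only derivatives of fields on which $Q$ is zero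
(`opQ_opPbar_bosonF`). The other three, $P\overline PG$, $Q\overline PG$ and $P\overline QG$, are
total derivatives. Here $G$ is a scalar $S$ times the volume density, and a diffeomorphism operator
sends such a density to a divergence $\partial_\rho(\varkappa K^\rho S\sqrt{-\det g})$
(`IsDiffeoOp.map_mul_volg`). So $\overline PG$ is a divergence, and it remains one under $P$ and
$Q$, which commute with $\partial_\mu$. For $P\overline QG$ one needs $\overline QS$ to be again a
scalar under $P$ (`isScalar_opQbar_bosonGScalar`): the gauge variations of $A$, $c$, $\overline c$
are built covariantly from covectors and scalars. Tensor calculus becomes algebra by subtracting the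
transport term: $\delta=R-\varkappa K^\rho\partial_\rho$ is still an odd derivation, annihilates
scalars, and acts on the metric and on covectors linearly through
$\Lambda_\mu{}^\rho=\varkappa\,\partial_\mu K^\rho$. Jacobi's formula then gives $\delta\sqrt{-\det
g}=\operatorname{tr}\Lambda\,\sqrt{-\det g}$, and contractions with $g^{\mu\nu}$ are annihilated. -/

lemma map_prod_eq_sum_erase [DecidableEq n] (D : Derivation R A M) (s : Finset n) (f : n → A) :
    D (∏ i ∈ s, f i) = ∑ i ∈ s, (∏ k ∈ s.erase i, f k) • D (f i) := by
  induction s using Finset.induction_on with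
  | empty => simp
  | insert a s ha ih =>
    rw [Finset.prod_insert ha, D.leibniz, ih, Finset.sum_insert ha, Finset.erase_insert ha,
      add_comm, Finset.smul_sum]
    congr 1
    refine Finset.sum_congr rfl fun i hi => ?_
    have hne : a ≠ i := fun h => ha (h ▸ hi)
    rw [Finset.erase_insert_of_ne hne, Finset.prod_insert (fun h => ha (Finset.mem_of_mem_erase h)),
      mul_smul]

/-- Jacobi's formula for the derivative of a determinant. -/
lemma map_det_eq_sum_adjugate [Fintype n] [DecidableEq n] (D : Derivation R A M)
    (g : Matrix n n A) : D g.det = ∑ i, ∑ j, g.adjugate j i • D (g i j) := by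
  -- Only permutations with `σ i = j` survive in the determinant whose `i`-th row is a unit vector.
  -- This is the cofactor that multiplies `D (g i j)` in the Leibniz expansion.
  have hadj : ∀ i j, g.adjugate j i = ∑ σ : Equiv.Perm n, if σ i = j then
      (Equiv.Perm.sign σ : ℤ) • ∏ k ∈ Finset.univ.erase i, g k (σ k) else 0 := fun i j => by
    rw [Matrix.adjugate_apply, ← Matrix.det_transpose, Matrix.det_apply]
    refine Finset.sum_congr rfl fun σ _ => ?_
    rw [← Finset.mul_prod_erase _ _ (Finset.mem_univ i), Matrix.transpose_apply,
      Matrix.updateRow_self, Units.smul_def]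
    have hprod : ∏ x ∈ Finset.univ.erase i, (g.updateRow i (Pi.single j 1)).transpose (σ x) x
        = ∏ k ∈ Finset.univ.erase i, g k (σ k) := Finset.prod_congr rfl fun k hk => by
      rw [Matrix.transpose_apply, Matrix.updateRow_ne (Finset.ne_of_mem_erase hk)]
    rw [hprod, Pi.single_apply]
    split_ifs <;> simp
  rw [← Matrix.det_transpose, Matrix.det_apply, map_sum]
  simp only [hadj, Finset.sum_smul]
  have hswap : ∀ i, ∑ j, ∑ σ : Equiv.Perm n, (if σ i = j then
      (Equiv.Perm.sign σ : ℤ) • ∏ k ∈ Finset.univ.erase i, g k (σ k) else 0) • D (g i j) =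
      ∑ σ : Equiv.Perm n, ((Equiv.Perm.sign σ : ℤ) • ∏ k ∈ Finset.univ.erase i, g k (σ k)) •
        D (g i (σ i)) := fun i => by
    rw [Finset.sum_comm]
    refine Finset.sum_congr rfl fun σ _ => ?_
    simp [ite_smul]
  simp only [hswap]
  rw [Finset.sum_comm]
  refine Finset.sum_congr rfl fun σ _ => ?_
  rw [Units.smul_def, map_zsmul]
  simp only [Matrix.transpose_apply, map_prod_eq_sum_erase, Finset.smul_sum, smul_assoc]

end Derivation

/-! ### Contraction as an antiderivation -/

namespace CliffordAlgebra

variable {R M : Type*} [CommRing R] [AddCommGroup M] [Module R M] {Q : QuadraticForm R M}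

/-- Each generator of `x` that the contraction passes costs a sign, and `involute` collects these
signs; hence the induction that peels generators off the left. This is the source of the sign in the
Leibniz rule for odd derivatives. -/
lemma contractLeft_mul (d : Module.Dual R M) (x y : CliffordAlgebra Q) :
    contractLeft d (x * y) = contractLeft d x * y + involute x * contractLeft d y := by
  induction x using CliffordAlgebra.left_induction with
  | algebraMap r =>
    rw [contractLeft_algebraMap_mul, contractLeft_algebraMap, zero_mul, zero_add,
      AlgHom.commutes]
  | add x x' hx hx' => simp only [add_mul, map_add, hx, hx']; abel
  | ι_mul x m hx =>
    rw [mul_assoc, contractLeft_ι_mul, hx, contractLeft_ι_mul, map_mul, involute_ι, sub_mul,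
      smul_mul_assoc, mul_add]
    simp only [neg_mul, mul_assoc]
    abel

end CliffordAlgebra

namespace BRST

variable {ι I₀ I₁ : Type*}

/-! ### Generators and the grade involution -/

lemma LocalAlg.tmul_eq (a : EvenAlg ι I₀) (b : ExteriorAlgebra ℝ (OddJet ι I₁ →₀ ℝ)) :
    (a ⊗ₜ[ℝ] b : EvenAlg ι I₀ ⊗[ℝ] ExteriorAlgebra ℝ (OddJet ι I₁ →₀ ℝ)) =
      (ofEven a * ofOdd b : LocalAlg ι I₀ I₁) := by
  have h := Algebra.TensorProduct.tmul_mul_tmul (R := ℝ) a 1 1 b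
  rw [one_mul, mul_one] at h
  exact h.symm

lemma LocalAlg.induction_tmul {p : LocalAlg ι I₀ I₁ → Prop} (h : ∀ a b, p (ofEven a * ofOdd b))
    (hadd : ∀ X Y, p X → p Y → p (X + Y)) (X : LocalAlg ι I₀ I₁) : p X := by
  refine TensorProduct.induction_on (motive := p) X ?_ (fun a b => ?_) hadd
  · have := h 0 0
    rwa [map_zero, zero_mul] at this
  · have := h a b
    rwa [← LocalAlg.tmul_eq] at this

/-- The volume factor `w = 1 / √(-det g)` as a local function. -/
noncomputable def invVol : LocalAlg ι I₀ I₁ := ofEven (toEvenAlg ι I₀ (MvPolynomial.X none))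

/-- Constants, jet coordinates and `invVol` generate the algebra. The inverse metric and
$\sqrt{-\det g}$ need no case of their own, being polynomials in these. -/
lemma LocalAlg.induction {p : LocalAlg ι I₀ I₁ → Prop} (X : LocalAlg ι I₀ I₁)
    (halg : ∀ r : ℝ, p (algebraMap ℝ _ r)) (heven : ∀ z, p (evenCoord z)) (hvol : p invVol)
    (hodd : ∀ z, p (oddCoord z)) (hadd : ∀ X Y, p X → p Y → p (X + Y))
    (hmul : ∀ X Y, p X → p Y → p (X * Y)) : p X := by
  refine LocalAlg.induction_tmul (fun a b => hmul _ _ ?_ ?_) hadd X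
  · obtain ⟨x, rfl⟩ := toEvenAlg_surjective ι I₀ a
    induction x using MvPolynomial.induction_on with
    | C r =>
      rw [← MvPolynomial.algebraMap_eq, AlgHom.commutes, AlgHom.commutes]
      exact halg r
    | add x y hx hy => rw [map_add, map_add]; exact hadd _ _ hx hy
    | mul_X x z hx =>
      rw [map_mul, map_mul]
      refine hmul _ _ hx ?_
      cases z with
      | none => exact hvol
      | some z => exact heven z
  · induction b using ExteriorAlgebra.induction with
    | algebraMap r => rw [AlgHom.commutes]; exact halg r
    | add x y hx hy => rw [map_add]; exact hadd _ _ hx hy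
    | mul x y hx hy => rw [map_mul]; exact hmul _ _ hx hy
    | ι m =>
      induction m using Finsupp.induction_linear with
      | zero => simpa using halg 0
      | add f g hf hg => rw [map_add, map_add]; exact hadd _ _ hf hg
      | single z r =>
        rw [show Finsupp.single z r = r • Finsupp.single z (1 : ℝ) by simp, map_smul, map_smul,
          Algebra.smul_def]
        exact hmul _ _ (halg r) (hodd z)

/-- The grade involution, which changes the sign of the odd coordinates. -/
noncomputable def gradeInv : LocalAlg ι I₀ I₁ →ₐ[ℝ] LocalAlg ι I₀ I₁ :=
  (Algebra.TensorProduct.map (AlgHom.id ℝ (EvenAlg ι I₀)) CliffordAlgebra.involute :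
    EvenAlg ι I₀ ⊗[ℝ] ExteriorAlgebra ℝ (OddJet ι I₁ →₀ ℝ) →ₐ[ℝ]
      EvenAlg ι I₀ ⊗[ℝ] ExteriorAlgebra ℝ (OddJet ι I₁ →₀ ℝ))

@[simp] lemma gradeInv_ofEven (a : EvenAlg ι I₀) :
    gradeInv (ofEven a : LocalAlg ι I₀ I₁) = ofEven a := by
  change (Algebra.TensorProduct.map (AlgHom.id ℝ (EvenAlg ι I₀)) CliffordAlgebra.involute
    (a ⊗ₜ[ℝ] (1 : ExteriorAlgebra ℝ (OddJet ι I₁ →₀ ℝ)))) = a ⊗ₜ[ℝ] 1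
  simp

lemma gradeInv_ofOdd (b : ExteriorAlgebra ℝ (OddJet ι I₁ →₀ ℝ)) :
    gradeInv (ofOdd b : LocalAlg ι I₀ I₁) = ofOdd (CliffordAlgebra.involute b) := by
  change (Algebra.TensorProduct.map (AlgHom.id ℝ (EvenAlg ι I₀)) CliffordAlgebra.involute
    ((1 : EvenAlg ι I₀) ⊗ₜ[ℝ] b)) = 1 ⊗ₜ[ℝ] CliffordAlgebra.involute b
  simp

@[simp] lemma gradeInv_evenCoord (z : EvenJet ι I₀) :
    gradeInv (evenCoord z : LocalAlg ι I₀ I₁) = evenCoord z := gradeInv_ofEven _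

@[simp] lemma gradeInv_oddCoord (z : OddJet ι I₁) :
    gradeInv (oddCoord z : LocalAlg ι I₀ I₁) = -oddCoord z := by
  rw [oddCoord, gradeInv_ofOdd, ExteriorAlgebra.ι, CliffordAlgebra.involute_ι, map_neg]

@[simp] lemma gradeInv_gradeInv (X : LocalAlg ι I₀ I₁) : gradeInv (gradeInv X) = X := by
  induction X using LocalAlg.induction with
  | halg r => simp
  | heven z => simp
  | hvol => simp [invVol]
  | hodd z => simp
  | hadd X Y hX hY => simp [hX, hY]
  | hmul X Y hX hY => simp [hX, hY]

/-- `V` commutes with all local functions up to the automorphism `σ`. -/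
def TwistedCentral (σ : LocalAlg ι I₀ I₁ →ₐ[ℝ] LocalAlg ι I₀ I₁) (V : LocalAlg ι I₀ I₁) : Prop :=
  ∀ X, V * X = σ X * V

/-- Even elements commute with everything. -/
abbrev IsEven (V : LocalAlg ι I₀ I₁) : Prop := TwistedCentral (AlgHom.id ℝ _) V

/-- Odd elements commute with everything up to the grade involution. -/
abbrev IsOdd (V : LocalAlg ι I₀ I₁) : Prop := TwistedCentral gradeInv V

lemma isEven_ofEven (a : EvenAlg ι I₀) : IsEven (ofEven a : LocalAlg ι I₀ I₁) := by
  intro X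
  induction X using LocalAlg.induction_tmul with
  | h b c =>
    have hc : (ofEven a * ofOdd c : LocalAlg ι I₀ I₁) = ofOdd c * ofEven a := by
      have h := Algebra.TensorProduct.tmul_mul_tmul (R := ℝ) 1 a c 1
      rw [one_mul, mul_one] at h
      rw [← LocalAlg.tmul_eq]
      exact h.symm
    rw [AlgHom.id_apply, mul_assoc, ← hc, ← mul_assoc, ← mul_assoc, ← map_mul, ← map_mul,
      mul_comm a b]
  | hadd X Y hX hY => simp only [map_add, mul_add, add_mul, hX, hY]

lemma isEven_evenCoord (z : EvenJet ι I₀) : IsEven (evenCoord z : LocalAlg ι I₀ I₁) :=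
  isEven_ofEven _

/-- The commutation rule is multiplicative in `X`, so generators suffice; the only sign comes from
anticommutation in the exterior algebra. Parity is used below only in this form, as a rule for
moving an element past an arbitrary one. -/
lemma isOdd_oddCoord (z : OddJet ι I₁) : IsOdd (oddCoord z : LocalAlg ι I₀ I₁) := by
  intro X
  induction X using LocalAlg.induction with
  | halg r => rw [AlgHom.commutes, Algebra.commutes]
  | heven z' => rw [gradeInv_evenCoord]; exact (isEven_evenCoord _ _).symm
  | hvol => rw [invVol, gradeInv_ofEven]; exact (isEven_ofEven _ _).symm
  | hodd z' =>
    have h : (ExteriorAlgebra.ι ℝ (Finsupp.single z (1 : ℝ)) *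
        ExteriorAlgebra.ι ℝ (Finsupp.single z' (1 : ℝ))) = -(ExteriorAlgebra.ι ℝ
        (Finsupp.single z' (1 : ℝ)) * ExteriorAlgebra.ι ℝ (Finsupp.single z (1 : ℝ))) :=
      eq_neg_of_add_eq_zero_left (ExteriorAlgebra.ι_add_mul_swap _ _)
    rw [gradeInv_oddCoord, oddCoord, oddCoord, ← map_mul, h, map_neg, map_mul, neg_mul]
  | hadd X Y hX hY => simp only [map_add, mul_add, add_mul, hX, hY]
  | hmul X Y hX hY => rw [← mul_assoc, hX, mul_assoc, hY, map_mul, mul_assoc]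

section Closure

variable {σ : LocalAlg ι I₀ I₁ →ₐ[ℝ] LocalAlg ι I₀ I₁} {V W : LocalAlg ι I₀ I₁}

lemma TwistedCentral.zero : TwistedCentral σ 0 := fun X => by simp

lemma TwistedCentral.add (hV : TwistedCentral σ V) (hW : TwistedCentral σ W) :
    TwistedCentral σ (V + W) := fun X => by rw [add_mul, hV, hW, mul_add]

lemma TwistedCentral.neg (hV : TwistedCentral σ V) : TwistedCentral σ (-V) := fun X => by
  rw [neg_mul, hV, mul_neg]

lemma TwistedCentral.sub (hV : TwistedCentral σ V) (hW : TwistedCentral σ W) :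
    TwistedCentral σ (V - W) := fun X => by rw [sub_mul, hV, hW, mul_sub]

lemma TwistedCentral.smul (r : ℝ) (hV : TwistedCentral σ V) : TwistedCentral σ (r • V) :=
  fun X => by rw [smul_mul_assoc, hV, mul_smul_comm]

lemma TwistedCentral.sum {κ : Type*} {s : Finset κ} {f : κ → LocalAlg ι I₀ I₁}
    (h : ∀ i, TwistedCentral σ (f i)) : TwistedCentral σ (∑ i ∈ s, f i) := fun X => by
  rw [Finset.sum_mul, Finset.mul_sum]
  exact Finset.sum_congr rfl fun i _ => h i X

lemma IsEven.mul (hV : IsEven V) (hW : TwistedCentral σ W) : TwistedCentral σ (V * W) := fun X => by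
  rw [mul_assoc, hW, hV, AlgHom.id_apply, mul_assoc, hV W, AlgHom.id_apply]

lemma IsOdd.mul_even (hV : IsOdd V) (hW : IsEven W) : IsOdd (V * W) := fun X => by
  rw [mul_assoc, hW, AlgHom.id_apply, ← mul_assoc, hV, mul_assoc]

lemma IsOdd.mul_odd (hV : IsOdd V) (hW : IsOdd W) : IsEven (V * W) := fun X => by
  rw [mul_assoc, hW, ← mul_assoc, hV, gradeInv_gradeInv, mul_assoc, AlgHom.id_apply]

end Closure

/-! ### Partial derivatives -/

lemma evenPartial_ofEven_mul (z : EvenJet ι I₀) (a : EvenAlg ι I₀)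
    (b : ExteriorAlgebra ℝ (OddJet ι I₁ →₀ ℝ)) :
    evenPartial z (ofEven a * ofOdd b : LocalAlg ι I₀ I₁) =
      ofEven (evenAlgPartial z a) * ofOdd b := by
  rw [← LocalAlg.tmul_eq, ← LocalAlg.tmul_eq]
  exact TensorProduct.map_tmul _ _ _ _

lemma oddPartial_ofEven_mul (z : OddJet ι I₁) (a : EvenAlg ι I₀)
    (b : ExteriorAlgebra ℝ (OddJet ι I₁ →₀ ℝ)) :
    oddPartial z (ofEven a * ofOdd b : LocalAlg ι I₀ I₁) =
      ofEven a * ofOdd (CliffordAlgebra.contractLeft (Finsupp.lapply z) b) := by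
  rw [← LocalAlg.tmul_eq, ← LocalAlg.tmul_eq]
  exact TensorProduct.map_tmul _ _ _ _

lemma ofEven_mul_ofOdd_mul (a a' : EvenAlg ι I₀) (b b' : ExteriorAlgebra ℝ (OddJet ι I₁ →₀ ℝ)) :
    (ofEven a * ofOdd b * (ofEven a' * ofOdd b') : LocalAlg ι I₀ I₁) =
      ofEven (a * a') * ofOdd (b * b') := by
  have h : (ofEven a' * ofOdd b : LocalAlg ι I₀ I₁) = ofOdd b * ofEven a' := isEven_ofEven a' _
  rw [map_mul, map_mul, mul_assoc, ← mul_assoc (ofOdd b), ← h, mul_assoc, mul_assoc]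

lemma evenPartial_mul (z : EvenJet ι I₀) (X Y : LocalAlg ι I₀ I₁) :
    evenPartial z (X * Y) = evenPartial z X * Y + X * evenPartial z Y := by
  induction X using LocalAlg.induction_tmul with
  | hadd X X' hX hX' => simp only [add_mul, map_add, hX, hX']; abel
  | h a b =>
    induction Y using LocalAlg.induction_tmul with
    | hadd Y Y' hY hY' => simp only [mul_add, map_add, hY, hY']; abel
    | h a' b' =>
      simp only [ofEven_mul_ofOdd_mul, evenPartial_ofEven_mul, Derivation.leibniz, smul_eq_mul,
        map_add, add_mul]
      rw [add_comm, mul_comm a']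

/-- On pure tensors the even factors are central and fixed by `gradeInv`, so the sign is that of the
contraction on the Grassmann factor. -/
lemma oddPartial_mul (z : OddJet ι I₁) (X Y : LocalAlg ι I₀ I₁) :
    oddPartial z (X * Y) = oddPartial z X * Y + gradeInv X * oddPartial z Y := by
  induction X using LocalAlg.induction_tmul with
  | hadd X X' hX hX' => simp only [add_mul, map_add, hX, hX']; abel
  | h a b =>
    induction Y using LocalAlg.induction_tmul with
    | hadd Y Y' hY hY' => simp only [mul_add, map_add, hY, hY']; abel
    | h a' b' =>
      simp only [ofEven_mul_ofOdd_mul, oddPartial_ofEven_mul, map_mul gradeInv, gradeInv_ofEven,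
        gradeInv_ofOdd, CliffordAlgebra.contractLeft_mul, map_add, mul_add]

lemma evenAlgPartial_toEvenAlg (z : EvenJet ι I₀) (x : PreEven ι I₀) :
    evenAlgPartial z (toEvenAlg ι I₀ x) = toEvenAlg ι I₀ (preEvenPartial z x) :=
  Derivation.liftOfSurjective_apply _ (preEvenPartial_mem z) _

lemma evenPartial_evenCoord [DecidableEq (EvenJet ι I₀)] (z z' : EvenJet ι I₀) :
    evenPartial z (evenCoord z' : LocalAlg ι I₀ I₁) = if z = z' then 1 else 0 := by
  have h := evenPartial_ofEven_mul (I₁ := I₁) z (toEvenAlg ι I₀ (MvPolynomial.X (some z'))) 1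
  rw [map_one, mul_one, mul_one, evenAlgPartial_toEvenAlg] at h
  rw [evenCoord, h, preEvenPartial]
  classical
  by_cases hz : z = z'
  · subst hz; simp [MvPolynomial.pderiv_X]
  · simp [MvPolynomial.pderiv_X, hz, eq_comm]

lemma evenPartial_oddCoord (z : EvenJet ι I₀) (z' : OddJet ι I₁) :
    evenPartial z (oddCoord z' : LocalAlg ι I₀ I₁) = 0 := by
  have h := evenPartial_ofEven_mul z (1 : EvenAlg ι I₀)
    (ExteriorAlgebra.ι ℝ (Finsupp.single z' (1 : ℝ)))
  rwa [map_one, one_mul, Derivation.map_one_eq_zero, map_zero, zero_mul] at h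

lemma oddPartial_ofEven (z : OddJet ι I₁) (a : EvenAlg ι I₀) :
    oddPartial z (ofEven a : LocalAlg ι I₀ I₁) = 0 := by
  have h := oddPartial_ofEven_mul z a 1
  rwa [map_one, mul_one, CliffordAlgebra.contractLeft_one, map_zero, mul_zero] at h

lemma oddPartial_oddCoord [DecidableEq (OddJet ι I₁)] (z z' : OddJet ι I₁) :
    oddPartial z (oddCoord z' : LocalAlg ι I₀ I₁) = if z = z' then 1 else 0 := by
  have h := oddPartial_ofEven_mul z (1 : EvenAlg ι I₀)
    (ExteriorAlgebra.ι ℝ (Finsupp.single z' (1 : ℝ)))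
  rw [map_one, one_mul, one_mul, ExteriorAlgebra.ι, CliffordAlgebra.contractLeft_ι] at h
  rw [oddCoord, ExteriorAlgebra.ι, h]
  classical
  by_cases hz : z = z'
  · subst hz; simp
  · simp [hz]

/-- `finsum` is zero by default on infinite support, so the sums in `vectorField` mean what they
should only because of this finiteness. -/
lemma finite_evenPartial_ne_zero (X : LocalAlg ι I₀ I₁) : {z | evenPartial z X ≠ 0}.Finite := by
  induction X using LocalAlg.induction_tmul with
  | hadd X Y hX hY =>
    refine (hX.union hY).subset fun z hz => ?_
    by_contra h
    simp only [Set.mem_union, Set.mem_ofPred_eq, not_or, not_not] at h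
    exact hz (by rw [map_add, h.1, h.2, add_zero])
  | h a b =>
    obtain ⟨x, rfl⟩ := toEvenAlg_surjective ι I₀ a
    -- The variables of $\det g$ are included because the chain rule for $w=1/\sqrt{-\det g}$ brings
    -- in derivatives of the determinant even if `x` contains no metric coordinate.
    have hfin : {z : EvenJet ι I₀ | some z ∈ (x.vars : Set _) ∪ (preDet ι I₀).vars}.Finite :=
      Set.Finite.preimage (Option.some_injective _).injOn
        ((Finset.finite_toSet _).union (Finset.finite_toSet _))
    refine hfin.subset fun z hz => ?_
    by_contra h
    simp only [Set.mem_ofPred_eq, Set.mem_union, Finset.mem_coe, not_or] at h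
    refine hz ?_
    rw [evenPartial_ofEven_mul, evenAlgPartial_toEvenAlg, preEvenPartial]
    simp [MvPolynomial.pderiv_eq_zero_of_notMem_vars h.1,
      MvPolynomial.pderiv_eq_zero_of_notMem_vars h.2]

lemma oddPartial_algebraMap (z : OddJet ι I₁) (r : ℝ) :
    oddPartial z (algebraMap ℝ (LocalAlg ι I₀ I₁) r) = 0 := by
  rw [← AlgHom.commutes ofEven, oddPartial_ofEven]

lemma finite_oddPartial_ne_zero (X : LocalAlg ι I₀ I₁) : {z | oddPartial z X ≠ 0}.Finite := by
  classical
  induction X using LocalAlg.induction with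
  | halg r => simp [oddPartial_algebraMap]
  | heven z => simp [evenCoord, oddPartial_ofEven]
  | hvol => simp [invVol, oddPartial_ofEven]
  | hodd z =>
    refine (Set.finite_singleton z).subset fun z' hz => ?_
    by_contra h
    exact hz (by rw [oddPartial_oddCoord, if_neg (by simpa using h)])
  | hadd X Y hX hY =>
    refine (hX.union hY).subset fun z hz => ?_
    by_contra h
    simp only [Set.mem_union, Set.mem_ofPred_eq, not_or, not_not] at h
    exact hz (by rw [map_add, h.1, h.2, add_zero])
  | hmul X Y hX hY =>
    refine (hX.union hY).subset fun z hz => ?_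
    by_contra h
    simp only [Set.mem_union, Set.mem_ofPred_eq, not_or, not_not] at h
    exact hz (by rw [oddPartial_mul, h.1, h.2, zero_mul, mul_zero, add_zero])

/-! ### Twisted derivations -/

/-- `d` is linear and `d (X Y) = d X Y + σ X d Y`. -/
structure IsTwistedDer (σ : LocalAlg ι I₀ I₁ →ₐ[ℝ] LocalAlg ι I₀ I₁)
    (d : LocalAlg ι I₀ I₁ → LocalAlg ι I₀ I₁) : Prop where
  add : ∀ X Y, d (X + Y) = d X + d Y
  smul : ∀ (r : ℝ) X, d (r • X) = r • d X
  leibniz : ∀ X Y, d (X * Y) = d X * Y + σ X * d Y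

namespace IsTwistedDer

variable {σ : LocalAlg ι I₀ I₁ →ₐ[ℝ] LocalAlg ι I₀ I₁} {d d' : LocalAlg ι I₀ I₁ → LocalAlg ι I₀ I₁}

/-- The underlying linear map. -/
def toLin (h : IsTwistedDer σ d) : LocalAlg ι I₀ I₁ →ₗ[ℝ] LocalAlg ι I₀ I₁ where
  toFun := d
  map_add' := h.add
  map_smul' := h.smul

lemma zero (h : IsTwistedDer σ d) : d 0 = 0 := h.toLin.map_zero

lemma neg (h : IsTwistedDer σ d) (X : LocalAlg ι I₀ I₁) : d (-X) = -d X := h.toLin.map_neg X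

lemma sub (h : IsTwistedDer σ d) (X Y : LocalAlg ι I₀ I₁) : d (X - Y) = d X - d Y :=
  h.toLin.map_sub X Y

lemma sum (h : IsTwistedDer σ d) {κ : Type*} (s : Finset κ) (f : κ → LocalAlg ι I₀ I₁) :
    d (∑ i ∈ s, f i) = ∑ i ∈ s, d (f i) := map_sum h.toLin f s

lemma one (h : IsTwistedDer σ d) : d 1 = 0 := by
  have := h.leibniz 1 1
  rwa [mul_one, mul_one, map_one, one_mul, left_eq_add] at this

lemma map_algebraMap (h : IsTwistedDer σ d) (r : ℝ) :
    d (algebraMap ℝ (LocalAlg ι I₀ I₁) r) = 0 := by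
  rw [Algebra.algebraMap_eq_smul_one, h.smul, h.one, smul_zero]

/-- For fixed `σ` the Leibniz rule is linear in the operator. This is what allows the transport term
to be subtracted from a diffeomorphism operator. -/
lemma sub_map (h : IsTwistedDer σ d) (h' : IsTwistedDer σ d') :
    IsTwistedDer σ (fun X => d X - d' X) where
  add X Y := by simp only [h.add, h'.add]; abel
  smul r X := by simp only [h.smul, h'.smul, smul_sub]
  leibniz X Y := by simp only [h.leibniz, h'.leibniz, sub_mul, mul_sub]; abel

end IsTwistedDer

lemma invVol_sq_mul_det : (invVol ^ 2 * ofEven (metricMatrix ι I₀).det : LocalAlg ι I₀ I₁) = -1 := by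
  rw [invVol, ← map_pow, ← map_mul, det_metricMatrix, map_neg, map_one]

lemma isEven_invVol : IsEven (invVol : LocalAlg ι I₀ I₁) := isEven_ofEven _

/-- On the even local functions a twisted derivation is a derivation; Jacobi's formula. -/
lemma IsTwistedDer.map_det {σ : LocalAlg ι I₀ I₁ →ₐ[ℝ] LocalAlg ι I₀ I₁}
    {d : LocalAlg ι I₀ I₁ → LocalAlg ι I₀ I₁} (h : IsTwistedDer σ d)
    (hσ : ∀ a, σ (ofEven a) = ofEven a) (g : Matrix (Fin 4) (Fin 4) (EvenAlg ι I₀)) :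
    d (ofEven g.det) = ∑ i, ∑ j, ofEven (g.adjugate j i) * d (ofEven (g i j)) := by
  -- Acting through `ofEven` makes the restriction of `d` a `Derivation` over a commutative ring,
  -- where Jacobi's formula applies. Its Leibniz rule has both coefficients on the left, which is
  -- legitimate because `ofEven b` is central.
  let _ : Module (EvenAlg ι I₀) (LocalAlg ι I₀ I₁) :=
    Module.compHom _ (ofEven : EvenAlg ι I₀ →ₐ[ℝ] LocalAlg ι I₀ I₁).toRingHom
  let D : Derivation ℝ (EvenAlg ι I₀) (LocalAlg ι I₀ I₁) :=
    { toLinearMap := h.toLin ∘ₗ ofEven.toLinearMap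
      map_one_eq_zero' := by
        change d (ofEven 1) = 0
        rw [map_one, h.one]
      leibniz' := fun a b => by
        change d (ofEven (a * b)) = ofEven a * d (ofEven b) + ofEven b * d (ofEven a)
        rw [map_mul, h.leibniz, hσ, isEven_ofEven b, AlgHom.id_apply, add_comm] }
  exact D.map_det_eq_sum_adjugate g

/-- Differentiate $w^2\det g=-1$, multiply by one more $w$, and use the relation again to replace
$w^2\det g$ in the term containing $dw$. -/
lemma IsTwistedDer.two_smul_map_invVol {σ : LocalAlg ι I₀ I₁ →ₐ[ℝ] LocalAlg ι I₀ I₁}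
    {d : LocalAlg ι I₀ I₁ → LocalAlg ι I₀ I₁} (h : IsTwistedDer σ d)
    (hσ : ∀ a, σ (ofEven a) = ofEven a) :
    (2 : ℝ) • d invVol = d (ofEven (metricMatrix ι I₀).det) * invVol ^ 3 := by
  have hw : ∀ X : LocalAlg ι I₀ I₁, invVol * X = X * invVol := isEven_invVol
  have hdet : ∀ X : LocalAlg ι I₀ I₁, ofEven (metricMatrix ι I₀).det * X =
    X * ofEven (metricMatrix ι I₀).det := isEven_ofEven _
  have h1 := congrArg d (invVol_sq_mul_det (ι := ι) (I₀ := I₀) (I₁ := I₁))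
  have hσw : σ invVol = invVol := hσ _
  rw [h.leibniz, h.neg, h.one, neg_zero, pow_two, h.leibniz, map_mul, hσw, hw (d invVol),
    mul_assoc, hw (invVol * _), hw (d (ofEven _)), ← add_mul, ← two_smul ℝ (d invVol)] at h1
  have h2 := congrArg (· * invVol) h1
  simp only [add_mul, smul_mul_assoc, zero_mul] at h2
  rw [mul_assoc, hdet, mul_assoc (d invVol), ← mul_assoc invVol, ← pow_two, invVol_sq_mul_det, mul_neg,
    mul_one, smul_neg, neg_add_eq_zero] at h2
  rw [h2, pow_succ, pow_two]
  simp only [mul_assoc]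

/-- A twisted derivation is determined by its values on the coordinates. -/
lemma IsTwistedDer.eq_zero {σ : LocalAlg ι I₀ I₁ →ₐ[ℝ] LocalAlg ι I₀ I₁}
    {d : LocalAlg ι I₀ I₁ → LocalAlg ι I₀ I₁} (h : IsTwistedDer σ d)
    (hσ : ∀ a, σ (ofEven a) = ofEven a) (heven : ∀ z, d (evenCoord z) = 0)
    (hodd : ∀ z, d (oddCoord z) = 0) (X : LocalAlg ι I₀ I₁) : d X = 0 := by
  induction X using LocalAlg.induction with
  | halg r => exact h.map_algebraMap r
  | heven z => exact heven z
  | hodd z => exact hodd z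
  | hadd X Y hX hY => rw [h.add, hX, hY, add_zero]
  | hmul X Y hX hY => rw [h.leibniz, hX, hY, zero_mul, mul_zero, add_zero]
  | hvol =>
    -- `invVol` is not a coordinate, but the relation with $\det g$ forces its derivative: $d\det
    -- g=0$ by Jacobi's formula, hence $2\,dw=0$.
    have hdet : d (ofEven (metricMatrix ι I₀).det) = 0 := by
      rw [h.map_det hσ]
      refine Finset.sum_eq_zero fun i _ => Finset.sum_eq_zero fun j _ => ?_
      rw [show ofEven (metricMatrix ι I₀ i j) = (evenCoord (.metric s(i, j), 0) :
        LocalAlg ι I₀ I₁) from rfl, heven, mul_zero]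
    have h1 := h.two_smul_map_invVol hσ
    rwa [hdet, zero_mul, smul_eq_zero_iff_right two_ne_zero] at h1

/-! ### Vector fields as twisted derivations -/

section VectorField

variable {V : EvenJet ι I₀ → LocalAlg ι I₀ I₁} {W : OddJet ι I₁ → LocalAlg ι I₀ I₁}

lemma finite_support_mul_evenPartial (V : EvenJet ι I₀ → LocalAlg ι I₀ I₁) (X : LocalAlg ι I₀ I₁) :
    (Function.support fun z => V z * evenPartial z X).Finite :=
  (finite_evenPartial_ne_zero X).subset fun z hz h => hz (by simp [h])

lemma finite_support_mul_oddPartial (W : OddJet ι I₁ → LocalAlg ι I₀ I₁) (X : LocalAlg ι I₀ I₁) :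
    (Function.support fun z => W z * oddPartial z X).Finite :=
  (finite_oddPartial_ne_zero X).subset fun z hz h => hz (by simp [h])

lemma finite_support_const_mul {κ : Type*} {f : κ → LocalAlg ι I₀ I₁}
    (hf : (Function.support f).Finite) (X : LocalAlg ι I₀ I₁) :
    (Function.support fun z => X * f z).Finite :=
  hf.subset fun z hz h => hz (by simp [h])

lemma finite_support_mul_const {κ : Type*} {f : κ → LocalAlg ι I₀ I₁}
    (hf : (Function.support f).Finite) (X : LocalAlg ι I₀ I₁) :
    (Function.support fun z => f z * X).Finite :=
  hf.subset fun z hz h => hz (by simp [h])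

/-- The odd partial derivative already contributes `gradeInv X`, so the coefficients `W` must turn
that into `σ X`, while those in `V` must produce `σ X` from `X`. One statement thus covers total
derivatives (`V` even, `W` odd, `σ` the identity) and BRST operators (`V` odd, `W` even, `σ =
gradeInv`). -/
lemma isTwistedDer_vectorField {σ : LocalAlg ι I₀ I₁ →ₐ[ℝ] LocalAlg ι I₀ I₁}
    (hV : ∀ z X, V z * X = σ X * V z) (hW : ∀ z X, W z * gradeInv X = σ X * W z) :
    IsTwistedDer σ (vectorField V W) where
  add X Y := by
    simp only [vectorField, map_add, mul_add]
    rw [finsum_add_distrib (finite_support_mul_evenPartial V X)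
      (finite_support_mul_evenPartial V Y),
      finsum_add_distrib (finite_support_mul_oddPartial W X) (finite_support_mul_oddPartial W Y)]
    abel
  smul r X := by
    simp only [vectorField, map_smul, mul_smul_comm, smul_add]
    rw [smul_finsum' r (finite_support_mul_evenPartial V X),
      smul_finsum' r (finite_support_mul_oddPartial W X)]
  leibniz X Y := by
    have heven : ∀ z, V z * evenPartial z (X * Y) =
        V z * evenPartial z X * Y + σ X * (V z * evenPartial z Y) := fun z => by
      rw [evenPartial_mul, mul_add, ← mul_assoc, ← mul_assoc, hV z X, mul_assoc (σ X)]
    have hodd : ∀ z, W z * oddPartial z (X * Y) =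
        W z * oddPartial z X * Y + σ X * (W z * oddPartial z Y) := fun z => by
      rw [oddPartial_mul, mul_add, ← mul_assoc, ← mul_assoc, hW z X, mul_assoc (σ X)]
    have hVX := finite_support_mul_evenPartial V X
    have hVY := finite_support_mul_evenPartial V Y
    have hWX := finite_support_mul_oddPartial W X
    have hWY := finite_support_mul_oddPartial W Y
    simp only [vectorField, heven, hodd]
    rw [finsum_add_distrib (finite_support_mul_const hVX Y) (finite_support_const_mul hVY _),
      finsum_add_distrib (finite_support_mul_const hWX Y) (finite_support_const_mul hWY _),
      ← finsum_mul' _ _ hVX, ← finsum_mul' _ _ hWX, ← mul_finsum' _ _ hVY, ← mul_finsum' _ _ hWY,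
      add_mul, mul_add]
    abel

@[simp] lemma vectorField_evenCoord (z : EvenJet ι I₀) : vectorField V W (evenCoord z) = V z := by
  classical
  have hodd : ∀ z', oddPartial z' (evenCoord z : LocalAlg ι I₀ I₁) = 0 :=
    fun z' => oddPartial_ofEven z' _
  simp only [vectorField, evenPartial_evenCoord, hodd, mul_zero, finsum_zero, add_zero]
  rw [finsum_eq_single _ z fun z' h => by rw [if_neg h, mul_zero], if_pos rfl, mul_one]

@[simp] lemma vectorField_oddCoord (z : OddJet ι I₁) : vectorField V W (oddCoord z) = W z := by
  classical
  simp only [vectorField, oddPartial_oddCoord, evenPartial_oddCoord, mul_zero, finsum_zero,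
    zero_add]
  rw [finsum_eq_single _ z fun z' h => by rw [if_neg h, mul_zero], if_pos rfl, mul_one]

end VectorField

/-! ### Total derivatives -/

lemma isTwistedDer_totalD (μ : Fin 4) :
    IsTwistedDer (AlgHom.id ℝ _) (totalD μ : LocalAlg ι I₀ I₁ → LocalAlg ι I₀ I₁) :=
  isTwistedDer_vectorField (fun z X => isEven_evenCoord _ X) fun z X => by
    rw [isOdd_oddCoord, gradeInv_gradeInv, AlgHom.id_apply]

lemma totalD_mul (μ : Fin 4) (X Y : LocalAlg ι I₀ I₁) :
    totalD μ (X * Y) = totalD μ X * Y + X * totalD μ Y := (isTwistedDer_totalD μ).leibniz X Y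

@[simp] lemma totalD_evenCoord (μ : Fin 4) (z : EvenJet ι I₀) :
    totalD μ (evenCoord z : LocalAlg ι I₀ I₁) = evenCoord (z.1, z.2 + Pi.single μ 1) :=
  vectorField_evenCoord z

@[simp] lemma totalD_oddCoord (μ : Fin 4) (z : OddJet ι I₁) :
    totalD μ (oddCoord z : LocalAlg ι I₀ I₁) = oddCoord (z.1, z.2 + Pi.single μ 1) :=
  vectorField_oddCoord z

/-- The commutator is again a derivation, and on coordinates it only compares two orders of raising
the multi-index. -/
lemma totalD_comm (μ ν : Fin 4) (X : LocalAlg ι I₀ I₁) :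
    totalD μ (totalD ν X) = totalD ν (totalD μ X) := by
  have h : IsTwistedDer (AlgHom.id ℝ (LocalAlg ι I₀ I₁))
      fun X => totalD μ (totalD ν X) - totalD ν (totalD μ X) :=
    { add := fun X Y => by simp only [(isTwistedDer_totalD _).add]; abel
      smul := fun r X => by simp only [(isTwistedDer_totalD _).smul, smul_sub]
      leibniz := fun X Y => by
        simp only [totalD_mul, (isTwistedDer_totalD _).add, AlgHom.id_apply, sub_mul, mul_sub]
        abel }
  refine sub_eq_zero.1 (h.eq_zero (fun _ => rfl) (fun z => ?_) (fun z => ?_) X)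
  · simp [add_right_comm]
  · simp [add_right_comm]

lemma gradeInv_totalD (μ : Fin 4) (X : LocalAlg ι I₀ I₁) :
    gradeInv (totalD μ X) = totalD μ (gradeInv X) := by
  have h : IsTwistedDer (AlgHom.id ℝ (LocalAlg ι I₀ I₁))
      fun X => gradeInv (totalD μ (gradeInv X)) - totalD μ X :=
    { add := fun X Y => by simp only [(isTwistedDer_totalD _).add, map_add]; abel
      smul := fun r X => by simp only [(isTwistedDer_totalD _).smul, map_smul, smul_sub]
      leibniz := fun X Y => by
        simp only [totalD_mul, map_mul, map_add, AlgHom.id_apply, sub_mul, mul_sub,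
          gradeInv_gradeInv]
        abel }
  have h' := h.eq_zero (fun _ => rfl) (fun z => by simp)
    (fun z => by simp [(isTwistedDer_totalD μ).neg]) (gradeInv X)
  rw [gradeInv_gradeInv] at h'
  exact sub_eq_zero.1 h'

/-- Differentiate the commutation rule $VX=\sigma(X)V$; the terms in which the derivative hits $X$
agree by the rule itself and cancel. -/
lemma TwistedCentral.totalD {σ : LocalAlg ι I₀ I₁ →ₐ[ℝ] LocalAlg ι I₀ I₁} {V : LocalAlg ι I₀ I₁}
    (hV : TwistedCentral σ V) {μ : Fin 4} (hσ : ∀ X, σ (totalD μ X) = BRST.totalD μ (σ X)) :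
    TwistedCentral σ (BRST.totalD μ V) := fun X => by
  have h := congrArg (BRST.totalD μ) (hV X)
  rw [totalD_mul, totalD_mul, hV, hσ, add_comm] at h
  exact add_left_cancel h

lemma IsEven.totalD {V : LocalAlg ι I₀ I₁} (hV : IsEven V) (μ : Fin 4) :
    IsEven (BRST.totalD μ V) := TwistedCentral.totalD hV fun _ => rfl

lemma IsOdd.totalD {V : LocalAlg ι I₀ I₁} (hV : IsOdd V) (μ : Fin 4) :
    IsOdd (BRST.totalD μ V) := TwistedCentral.totalD hV (gradeInv_totalD μ)

lemma iterD_add_single (J : MultiIndex) (μ : Fin 4) (X : LocalAlg ι I₀ I₁) :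
    iterD (J + Pi.single μ 1) X = totalD μ (iterD J X) := by
  have hcomm : ∀ ν ρ n (Y : LocalAlg ι I₀ I₁),
      (totalD ν)^[n] (totalD ρ Y) = totalD ρ ((totalD ν)^[n] Y) := fun ν ρ n =>
    (Function.Commute.iterate_left (totalD_comm ν ρ) n)
  fin_cases μ <;> simp [iterD, Function.iterate_succ_apply, hcomm]

lemma iterD_induction {p : LocalAlg ι I₀ I₁ → Prop} (h : ∀ μ X, p X → p (totalD μ X))
    (J : MultiIndex) {X : LocalAlg ι I₀ I₁} (hX : p X) : p (iterD J X) := by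
  have hiter : ∀ μ n (Y : LocalAlg ι I₀ I₁), p Y → p ((totalD μ)^[n] Y) := fun μ n => by
    induction n with
    | zero => exact fun Y hY => hY
    | succ n ih => exact fun Y hY => ih _ (h μ Y hY)
  exact hiter _ _ _ (hiter _ _ _ (hiter _ _ _ (hiter _ _ _ hX)))

/-! ### Prolongations -/

section Prolong

variable {p : EvenField ι I₀ → LocalAlg ι I₀ I₁} {q : OddField ι I₁ → LocalAlg ι I₀ I₁}

lemma isTwistedDer_prolong (hp : ∀ u, IsOdd (p u)) (hq : ∀ θ, IsEven (q θ)) :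
    IsTwistedDer gradeInv (prolong p q) :=
  isTwistedDer_vectorField
    (fun z => iterD_induction (p := IsOdd) (fun μ _ hX => hX.totalD μ) z.2 (hp z.1))
    (fun z X => iterD_induction (p := IsEven) (fun μ _ hX => hX.totalD μ) z.2 (hq z.1) (gradeInv X))

/-- The commutator is a twisted derivation, and prolongation is defined so that it vanishes on every
jet coordinate. -/
lemma prolong_totalD (hp : ∀ u, IsOdd (p u)) (hq : ∀ θ, IsEven (q θ)) (μ : Fin 4)
    (X : LocalAlg ι I₀ I₁) : prolong p q (totalD μ X) = totalD μ (prolong p q X) := by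
  have hR := isTwistedDer_prolong hp hq
  have h : IsTwistedDer gradeInv
      fun X => prolong p q (totalD μ X) - totalD μ (prolong p q X) :=
    { add := fun X Y => by simp only [(isTwistedDer_totalD _).add, hR.add]; abel
      smul := fun r X => by simp only [(isTwistedDer_totalD _).smul, hR.smul, smul_sub]
      leibniz := fun X Y => by
        simp only [totalD_mul, hR.leibniz, hR.add, (isTwistedDer_totalD _).add, sub_mul, mul_sub,
          gradeInv_totalD]
        abel }
  refine sub_eq_zero.1 (h.eq_zero gradeInv_ofEven (fun z => ?_) (fun z => ?_) X)
  · simp [prolong, iterD_add_single]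
  · simp [prolong, iterD_add_single]

lemma prolong_evenCoord (u : EvenField ι I₀) : prolong p q (evenCoord (u, 0)) = p u :=
  vectorField_evenCoord _

lemma prolong_oddCoord (θ : OddField ι I₁) : prolong p q (oddCoord (θ, 0)) = q θ :=
  vectorField_oddCoord _

end Prolong

/-! ### Odd derivations acting linearly on the metric -/

section MetricAction

variable {δ : LocalAlg ι I₀ I₁ → LocalAlg ι I₀ I₁} {Λ : Fin 4 → Fin 4 → LocalAlg ι I₀ I₁}

/-- Jacobi's formula contracts the adjugate with $\Lambda g+g\Lambda^{T}$. Since adjugate times $g$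
is $\det g$ on either side, each summand yields $\operatorname{tr}\Lambda\,\det g$, whence the
factor two. -/
lemma map_det_of_metricAction (hδ : IsTwistedDer gradeInv δ)
    (hmet : ∀ μ ν, δ (met μ ν) = ∑ ρ, (Λ μ ρ * met ρ ν + Λ ν ρ * met μ ρ)) :
    δ (ofEven (metricMatrix ι I₀).det) =
      (2 : ℝ) • ((∑ ρ, Λ ρ ρ) * ofEven (metricMatrix ι I₀).det) := by
  set g := metricMatrix ι I₀ with hg
  have hcomm : ∀ (a b : EvenAlg ι I₀) (L : LocalAlg ι I₀ I₁),
      ofEven a * (L * ofEven b) = L * ofEven (b * a) := fun a b L => by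
    rw [isEven_ofEven a, AlgHom.id_apply, mul_assoc, ← map_mul]
  have hadj : ∀ ρ i, ∑ j, g ρ j * g.adjugate j i = if ρ = i then g.det else 0 := fun ρ i => by
    rw [← Matrix.mul_apply, Matrix.mul_adjugate, Matrix.smul_apply, Matrix.one_apply]
    simp
  have hadj' : ∀ j ρ, ∑ i, g i ρ * g.adjugate j i = if ρ = j then g.det else 0 := fun j ρ => by
    simp only [mul_comm (g _ ρ)]
    rw [← Matrix.mul_apply, Matrix.adjugate_mul, Matrix.smul_apply, Matrix.one_apply]
    simp [eq_comm]
  have hfirst : ∑ i, ∑ j, ∑ ρ, Λ i ρ * ofEven (g ρ j * g.adjugate j i) =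
      (∑ ρ, Λ ρ ρ) * (ofEven g.det : LocalAlg ι I₀ I₁) := by
    rw [Finset.sum_mul]
    refine Finset.sum_congr rfl fun i _ => ?_
    rw [Finset.sum_comm]
    simp only [← Finset.mul_sum, ← map_sum, hadj]
    simp [apply_ite ofEven]
  have hsecond : ∑ i, ∑ j, ∑ ρ, Λ j ρ * ofEven (g i ρ * g.adjugate j i) =
      (∑ ρ, Λ ρ ρ) * (ofEven g.det : LocalAlg ι I₀ I₁) := by
    rw [Finset.sum_mul, Finset.sum_comm]
    refine Finset.sum_congr rfl fun j _ => ?_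
    rw [Finset.sum_comm]
    simp only [← Finset.mul_sum, ← map_sum, hadj']
    simp [apply_ite ofEven]
  have hterm : ∀ i j, ofEven (g.adjugate j i) * δ (ofEven (g i j)) =
      ∑ ρ, Λ i ρ * ofEven (g ρ j * g.adjugate j i) +
        ∑ ρ, Λ j ρ * ofEven (g i ρ * g.adjugate j i) := fun i j => by
    rw [show (ofEven (g i j) : LocalAlg ι I₀ I₁) = met i j from rfl, hmet, Finset.mul_sum,
      ← Finset.sum_add_distrib]
    exact Finset.sum_congr rfl fun ρ _ => by
      rw [mul_add]
      exact congrArg₂ _ (hcomm _ _ _) (hcomm _ _ _)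
  rw [hδ.map_det gradeInv_ofEven]
  simp only [hterm, Finset.sum_add_distrib]
  rw [hfirst, hsecond, two_smul]

/-- With $\sqrt{-\det g}=-w\det g$, the factor $w$ scales by $-\operatorname{tr}\Lambda$ and the
determinant by $2\operatorname{tr}\Lambda$. -/
lemma map_volg_of_metricAction (hδ : IsTwistedDer gradeInv δ)
    (hmet : ∀ μ ν, δ (met μ ν) = ∑ ρ, (Λ μ ρ * met ρ ν + Λ ν ρ * met μ ρ)) :
    δ volg = (∑ ρ, Λ ρ ρ) * volg := by
  have hdet := map_det_of_metricAction hδ hmet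
  have hcomm : ∀ X : LocalAlg ι I₀ I₁, invVol * X = X * invVol := isEven_invVol
  have hvol : (volg : LocalAlg ι I₀ I₁) = -(invVol * ofEven (metricMatrix ι I₀).det) := by
    rw [volg, sqrtNegDet, map_neg, map_mul, invVol]
  have hw : δ invVol = -((∑ ρ, Λ ρ ρ) * invVol) := by
    have h := hδ.two_smul_map_invVol gradeInv_ofEven
    rw [hdet, smul_mul_assoc] at h
    have h' : δ invVol = (∑ ρ, Λ ρ ρ) * ofEven (metricMatrix ι I₀).det * invVol ^ 3 :=
      smul_right_injective _ (two_ne_zero (α := ℝ)) h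
    rw [h', pow_succ, mul_assoc, ← mul_assoc (ofEven _),
      isEven_ofEven (metricMatrix ι I₀).det (invVol ^ 2), AlgHom.id_apply, invVol_sq_mul_det]
    simp
  have hσ : gradeInv (invVol : LocalAlg ι I₀ I₁) = invVol := gradeInv_ofEven _
  rw [hvol, hδ.neg, hδ.leibniz, hσ, hdet, hw, mul_smul_comm, ← mul_assoc invVol, hcomm, two_smul,
    neg_mul, mul_neg, neg_add_cancel_left, mul_assoc]

/-- Apply $\delta$ to $g^{-1}g=1$ and solve: $\delta g^{-1}=-g^{-1}(\delta g)g^{-1}$ with $\delta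
g=\Lambda g+g\Lambda^{T}$. -/
lemma map_metInv_of_metricAction (hδ : IsTwistedDer gradeInv δ)
    (hmet : ∀ μ ν, δ (met μ ν) = ∑ ρ, (Λ μ ρ * met ρ ν + Λ ν ρ * met μ ρ)) (μ ν : Fin 4) :
    δ (metInv μ ν) = -∑ ρ, (metInv μ ρ * Λ ρ ν + metInv ρ ν * Λ ρ μ) := by
  let g : Matrix (Fin 4) (Fin 4) (LocalAlg ι I₀ I₁) := .of met
  let g' : Matrix (Fin 4) (Fin 4) (LocalAlg ι I₀ I₁) := .of metInv
  let L : Matrix (Fin 4) (Fin 4) (LocalAlg ι I₀ I₁) := .of Λ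
  have hg : g = (metricMatrix ι I₀).map ofEven := rfl
  have hg' : g' = (metricMatrix ι I₀)⁻¹.map ofEven := rfl
  have hunit := isUnit_det_metricMatrix ι I₀
  -- The local algebra is not commutative, so inversion takes place over `EvenAlg` and the identity
  -- is transported along `ofEven`.
  have hleft : g' * g = 1 := by
    rw [hg, hg', ← Matrix.map_mul, Matrix.nonsing_inv_mul _ hunit, Matrix.map_one] <;> simp
  have hright : g * g' = 1 := by
    rw [hg, hg', ← Matrix.map_mul, Matrix.mul_nonsing_inv _ hunit, Matrix.map_one] <;> simp
  have hδg : g.map δ = L * g + g * L.transpose := by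
    ext i j
    rw [Matrix.map_apply, Matrix.add_apply, Matrix.mul_apply, Matrix.mul_apply]
    refine (hmet i j).trans ?_
    rw [Finset.sum_add_distrib]
    congr 1
    exact Finset.sum_congr rfl fun ρ _ => (isEven_evenCoord _ (Λ j ρ)).symm
  have hprod : g'.map δ * g + g' * g.map δ = 0 := by
    have h : (g' * g).map δ = 0 := by
      rw [hleft]
      ext i j
      rw [Matrix.map_apply, Matrix.one_apply, Matrix.zero_apply]
      split_ifs
      exacts [hδ.one, hδ.zero]
    rw [← h]
    ext i j
    simp only [Matrix.add_apply, Matrix.mul_apply, Matrix.map_apply]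
    rw [hδ.sum, ← Finset.sum_add_distrib]
    refine Finset.sum_congr rfl fun k _ => ?_
    rw [hδ.leibniz, show gradeInv (g' i k) = g' i k from gradeInv_ofEven _]
  have hmain : g'.map δ = -(g' * L + L.transpose * g') := by
    have h := congrArg (· * g') hprod
    simp only [add_mul, zero_mul] at h
    rw [mul_assoc, hright, mul_one, hδg, mul_add, ← mul_assoc g' g, hleft, one_mul, add_mul,
      mul_assoc, mul_assoc, hright, mul_one] at h
    exact eq_neg_of_add_eq_zero_left h
  have h := congrFun (congrFun hmain μ) ν
  refine h.trans ?_
  rw [Matrix.neg_apply, Matrix.add_apply, Matrix.mul_apply, Matrix.mul_apply,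
    ← Finset.sum_add_distrib]
  congr 1
  exact Finset.sum_congr rfl fun ρ _ => congrArg₂ _ rfl (isEven_ofEven _ (Λ ρ μ)).symm

/-- The variation of the inverse metric cancels those of `X` and `Y` after relabelling indices.
Oddness of `Λ` absorbs the Leibniz sign in front of the variation of `Y`, so `X` and `Y` may have
any parity; this matters since the odd covector $\overline QA$ is contracted too. -/
lemma map_contraction_of_metricAction (hδ : IsTwistedDer gradeInv δ) (hΛ : ∀ μ ρ, IsOdd (Λ μ ρ))
    (hmet : ∀ μ ν, δ (met μ ν) = ∑ ρ, (Λ μ ρ * met ρ ν + Λ ν ρ * met μ ρ))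
    {X Y : Fin 4 → LocalAlg ι I₀ I₁} (hX : ∀ μ, δ (X μ) = ∑ ρ, Λ μ ρ * X ρ)
    (hY : ∀ μ, δ (Y μ) = ∑ ρ, Λ μ ρ * Y ρ) :
    δ (∑ μ, ∑ ν, metInv μ ν * X μ * Y ν) = 0 := by
  have hterm : ∀ μ ν, δ (metInv μ ν * X μ * Y ν) =
      ∑ ρ, metInv μ ν * Λ ν ρ * X μ * Y ρ - ∑ ρ, metInv μ ρ * Λ ρ ν * X μ * Y ν +
      (∑ ρ, metInv μ ν * Λ μ ρ * X ρ * Y ν - ∑ ρ, metInv ρ ν * Λ ρ μ * X μ * Y ν) := fun μ ν => by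
    have hσ : gradeInv (metInv μ ν : LocalAlg ι I₀ I₁) = metInv μ ν := gradeInv_ofEven _
    have hX' : ∀ ρ, gradeInv (X μ) * (Λ ν ρ * Y ρ) = Λ ν ρ * (X μ * Y ρ) := fun ρ => by
      rw [← mul_assoc, ← hΛ, mul_assoc]
    rw [hδ.leibniz, hδ.leibniz, map_mul, hσ, map_metInv_of_metricAction hδ hmet, hX, hY, mul_assoc,
      Finset.mul_sum (f := fun ρ => Λ ν ρ * Y ρ)]
    simp only [hX', Finset.mul_sum, Finset.sum_mul, Finset.sum_add_distrib, add_mul, neg_mul,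
      neg_add, mul_assoc]
    abel
  simp only [hδ.sum, hterm, Finset.sum_add_distrib, Finset.sum_sub_distrib]
  have h1 : ∑ μ, ∑ ν, ∑ ρ, metInv μ ν * Λ ν ρ * X μ * Y ρ =
      ∑ μ, ∑ ν, ∑ ρ, metInv μ ρ * Λ ρ ν * X μ * Y ν :=
    Finset.sum_congr rfl fun μ _ => Finset.sum_comm
  have h2 : ∑ μ, ∑ ν, ∑ ρ, metInv μ ν * Λ μ ρ * X ρ * Y ν =
      ∑ μ, ∑ ν, ∑ ρ, metInv ρ ν * Λ ρ μ * X μ * Y ν := by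
    rw [Finset.sum_comm]
    refine (Finset.sum_congr rfl fun ν _ => Finset.sum_comm).trans ?_
    exact Finset.sum_comm
  rw [h1, h2, sub_self, sub_self, add_zero]

end MetricAction

/-! ### Diffeomorphism operators -/

/-- `R` is an odd derivation that commutes with the total derivatives and acts on the metric as
`ϰ £_K`. -/
structure IsDiffeoOp (ϰ : ℝ) (K : Fin 4 → LocalAlg ι I₀ I₁)
    (R : LocalAlg ι I₀ I₁ → LocalAlg ι I₀ I₁) : Prop where
  der : IsTwistedDer gradeInv R
  map_totalD : ∀ μ X, R (totalD μ X) = totalD μ (R X)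
  odd : ∀ ρ, IsOdd (K ρ)
  map_met : ∀ μ ν, R (met μ ν) = ϰ • lieMetric K μ ν

/-- `R` acts on `S` as `ϰ £_K` acts on a scalar. -/
def IsScalar (ϰ : ℝ) (K : Fin 4 → LocalAlg ι I₀ I₁) (R : LocalAlg ι I₀ I₁ → LocalAlg ι I₀ I₁)
    (S : LocalAlg ι I₀ I₁) : Prop :=
  R S = ϰ • lieScalar K S

/-- `R` acts on `X` as `ϰ £_K` acts on a covector. -/
def IsCovector (ϰ : ℝ) (K : Fin 4 → LocalAlg ι I₀ I₁) (R : LocalAlg ι I₀ I₁ → LocalAlg ι I₀ I₁)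
    (X : Fin 4 → LocalAlg ι I₀ I₁) : Prop :=
  ∀ μ, R (X μ) = ϰ • lieCovector K X μ

lemma isTwistedDer_smul_lieScalar (ϰ : ℝ) {K : Fin 4 → LocalAlg ι I₀ I₁}
    (hK : ∀ ρ, IsOdd (K ρ)) : IsTwistedDer gradeInv fun X => ϰ • lieScalar K X where
  add X Y := by
    simp only [lieScalar, (isTwistedDer_totalD _).add, mul_add, Finset.sum_add_distrib, smul_add]
  smul r X := by
    simp only [lieScalar, (isTwistedDer_totalD _).smul, mul_smul_comm, ← Finset.smul_sum]
    rw [smul_comm]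
  leibniz X Y := by
    rw [smul_mul_assoc, mul_smul_comm, ← smul_add, lieScalar, lieScalar, lieScalar, Finset.sum_mul,
      Finset.mul_sum, ← Finset.sum_add_distrib]
    congr 1
    refine Finset.sum_congr rfl fun ρ _ => ?_
    rw [totalD_mul, mul_add, ← mul_assoc, ← mul_assoc, hK ρ X, mul_assoc (gradeInv X)]

namespace IsDiffeoOp

variable {ϰ : ℝ} {K : Fin 4 → LocalAlg ι I₀ I₁} {R : LocalAlg ι I₀ I₁ → LocalAlg ι I₀ I₁}

/-- This remainder no longer differentiates the tensors it acts on, and its kernel is exactly the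
set of scalars in the sense of `IsScalar`. The closure properties below are therefore consequences
of its Leibniz rule and linearity. -/
lemma der_sub (h : IsDiffeoOp ϰ K R) : IsTwistedDer gradeInv fun X => R X - ϰ • lieScalar K X :=
  h.der.sub_map (isTwistedDer_smul_lieScalar ϰ h.odd)

lemma sub_map_met (h : IsDiffeoOp ϰ K R) (μ ν : Fin 4) :
    R (met μ ν) - ϰ • lieScalar K (met μ ν) =
      ∑ ρ, ((ϰ • totalD μ (K ρ)) * met ρ ν + (ϰ • totalD ν (K ρ)) * met μ ρ) := by
  rw [h.map_met, ← smul_sub, lieMetric, lieScalar, ← Finset.sum_sub_distrib, Finset.smul_sum]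
  refine Finset.sum_congr rfl fun ρ _ => ?_
  rw [smul_mul_assoc, smul_mul_assoc, ← smul_add]
  congr 1
  abel

lemma sub_map_covector {X : Fin 4 → LocalAlg ι I₀ I₁} (hX : IsCovector ϰ K R X) (μ : Fin 4) :
    R (X μ) - ϰ • lieScalar K (X μ) = ∑ ρ, (ϰ • totalD μ (K ρ)) * X ρ := by
  rw [hX, ← smul_sub, lieCovector, lieScalar, ← Finset.sum_sub_distrib, Finset.smul_sum]
  refine Finset.sum_congr rfl fun ρ _ => ?_
  rw [smul_mul_assoc, add_sub_cancel_left]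

lemma isScalar_contraction (h : IsDiffeoOp ϰ K R) {X Y : Fin 4 → LocalAlg ι I₀ I₁}
    (hX : IsCovector ϰ K R X) (hY : IsCovector ϰ K R Y) :
    IsScalar ϰ K R (∑ μ, ∑ ν, metInv μ ν * X μ * Y ν) :=
  sub_eq_zero.1 (map_contraction_of_metricAction h.der_sub
    (fun μ ρ => ((h.odd ρ).totalD μ).smul ϰ) h.sub_map_met (sub_map_covector hX)
    (sub_map_covector hY))

/-- A scalar times the volume form transforms into a total derivative. -/
lemma map_mul_volg (h : IsDiffeoOp ϰ K R) {S : LocalAlg ι I₀ I₁} (hS : IsScalar ϰ K R S) :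
    R (S * volg) = ∑ ρ, totalD ρ (ϰ • (K ρ * (S * volg))) := by
  have hS' : R S - ϰ • lieScalar K S = 0 := sub_eq_zero.2 hS
  have hvol := map_volg_of_metricAction h.der_sub h.sub_map_met
  -- The remainder turns `S * volg` into `gradeInv S` times $\operatorname{tr}\Lambda$ times the
  -- volume. Moving the odd trace to the front restores `S`, whatever its parity, and the product
  -- rule for $\partial_\rho(K^\rho\,\cdot)$ then assembles the divergence.
  have hΛ : IsOdd (∑ ρ, ϰ • totalD ρ (K ρ)) :=
    TwistedCentral.sum fun ρ => ((h.odd ρ).totalD ρ).smul ϰ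
  have hmul := h.der_sub.leibniz S volg
  rw [hS', zero_mul, zero_add, hvol, ← mul_assoc, ← hΛ, sub_eq_iff_eq_add, mul_assoc] at hmul
  rw [hmul, lieScalar, Finset.smul_sum, Finset.sum_mul, ← Finset.sum_add_distrib]
  refine Finset.sum_congr rfl fun ρ _ => ?_
  rw [(isTwistedDer_totalD ρ).smul, totalD_mul ρ (K ρ), smul_add, smul_mul_assoc]

lemma isScalar_mul (h : IsDiffeoOp ϰ K R) {S T : LocalAlg ι I₀ I₁} (hS : IsScalar ϰ K R S)
    (hT : IsScalar ϰ K R T) : IsScalar ϰ K R (S * T) := by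
  have hmul := h.der_sub.leibniz S T
  rw [sub_eq_zero.2 hS, sub_eq_zero.2 hT, zero_mul, mul_zero, add_zero] at hmul
  exact sub_eq_zero.1 hmul

lemma isScalar_add (h : IsDiffeoOp ϰ K R) {S T : LocalAlg ι I₀ I₁} (hS : IsScalar ϰ K R S)
    (hT : IsScalar ϰ K R T) : IsScalar ϰ K R (S + T) := by
  refine (h.der.add S T).trans ?_
  rw [hS, hT]
  exact ((isTwistedDer_smul_lieScalar ϰ h.odd).add S T).symm

lemma isScalar_smul (h : IsDiffeoOp ϰ K R) (r : ℝ) {S : LocalAlg ι I₀ I₁}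
    (hS : IsScalar ϰ K R S) : IsScalar ϰ K R (r • S) := by
  refine (h.der.smul r S).trans ?_
  rw [hS]
  exact ((isTwistedDer_smul_lieScalar ϰ h.odd).smul r S).symm

lemma isScalar_neg (h : IsDiffeoOp ϰ K R) {S : LocalAlg ι I₀ I₁} (hS : IsScalar ϰ K R S) :
    IsScalar ϰ K R (-S) := by
  rw [← neg_one_smul ℝ S]
  exact h.isScalar_smul _ hS

lemma isScalar_sub (h : IsDiffeoOp ϰ K R) {S T : LocalAlg ι I₀ I₁} (hS : IsScalar ϰ K R S)
    (hT : IsScalar ϰ K R T) : IsScalar ϰ K R (S - T) := by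
  rw [sub_eq_add_neg]
  exact h.isScalar_add hS (h.isScalar_neg hT)

lemma isScalar_sum (h : IsDiffeoOp ϰ K R) {κ : Type*} {s : Finset κ} {f : κ → LocalAlg ι I₀ I₁}
    (hf : ∀ i, IsScalar ϰ K R (f i)) : IsScalar ϰ K R (∑ i ∈ s, f i) := by
  refine (h.der.sum s f).trans ?_
  refine (Finset.sum_congr rfl fun i _ => hf i).trans ?_
  exact ((isTwistedDer_smul_lieScalar ϰ h.odd).sum s f).symm

/-- In this form the covector law is an algebraic condition on the remainder derivation, from which
sums and products with scalars follow. -/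
lemma isCovector_iff {X : Fin 4 → LocalAlg ι I₀ I₁} : IsCovector ϰ K R X ↔
    ∀ μ, R (X μ) - ϰ • lieScalar K (X μ) = ∑ ρ, (ϰ • totalD μ (K ρ)) * X ρ := by
  refine ⟨sub_map_covector, fun hX μ => ?_⟩
  rw [sub_eq_iff_eq_add.1 (hX μ), lieCovector, lieScalar, Finset.sum_add_distrib, smul_add,
    add_comm]
  congr 1
  simp only [smul_mul_assoc, Finset.smul_sum]

lemma isCovector_add (h : IsDiffeoOp ϰ K R) {X Y : Fin 4 → LocalAlg ι I₀ I₁}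
    (hX : IsCovector ϰ K R X) (hY : IsCovector ϰ K R Y) :
    IsCovector ϰ K R fun μ => X μ + Y μ := by
  refine isCovector_iff.2 fun μ => (h.der_sub.add (X μ) (Y μ)).trans ?_
  simp only [sub_map_covector hX, sub_map_covector hY, mul_add, Finset.sum_add_distrib]

lemma isCovector_smul (h : IsDiffeoOp ϰ K R) (r : ℝ) {X : Fin 4 → LocalAlg ι I₀ I₁}
    (hX : IsCovector ϰ K R X) : IsCovector ϰ K R fun μ => r • X μ := by
  refine isCovector_iff.2 fun μ => (h.der_sub.smul r (X μ)).trans ?_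
  simp only [sub_map_covector hX, mul_smul_comm, Finset.smul_sum]

lemma isCovector_sum (h : IsDiffeoOp ϰ K R) {κ : Type*} {s : Finset κ}
    {f : κ → Fin 4 → LocalAlg ι I₀ I₁} (hf : ∀ i, IsCovector ϰ K R (f i)) :
    IsCovector ϰ K R fun μ => ∑ i ∈ s, f i μ := by
  refine isCovector_iff.2 fun μ => (h.der_sub.sum s fun i => f i μ).trans ?_
  simp only [sub_map_covector (hf _), Finset.mul_sum]
  exact Finset.sum_comm

lemma isCovector_mul (h : IsDiffeoOp ϰ K R) {S : LocalAlg ι I₀ I₁}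
    {X : Fin 4 → LocalAlg ι I₀ I₁} (hS : IsScalar ϰ K R S) (hX : IsCovector ϰ K R X) :
    IsCovector ϰ K R fun μ => S * X μ := by
  refine isCovector_iff.2 fun μ => (h.der_sub.leibniz S (X μ)).trans ?_
  rw [sub_eq_zero.2 hS, sub_map_covector hX, zero_mul, zero_add, Finset.mul_sum]
  refine Finset.sum_congr rfl fun ρ _ => ?_
  rw [← mul_assoc, ← ((h.odd ρ).totalD μ).smul ϰ S, mul_assoc]

/-- The gradient of a scalar is a covector. -/
lemma isCovector_totalD (h : IsDiffeoOp ϰ K R) {S : LocalAlg ι I₀ I₁} (hS : IsScalar ϰ K R S) :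
    IsCovector ϰ K R fun μ => totalD μ S := fun μ => by
  rw [h.map_totalD, hS, (isTwistedDer_totalD μ).smul, lieScalar, (isTwistedDer_totalD μ).sum,
    lieCovector]
  congr 1
  refine Finset.sum_congr rfl fun ρ _ => ?_
  -- Commuting $\partial_\mu$ with $\partial_\rho$ produces the transport term, and $\partial_\mu
  -- K^\rho\,\partial_\rho S$ is the index term of a covector.
  rw [totalD_mul, totalD_comm, add_comm]

end IsDiffeoOp

end BRST

namespace BRST

variable {𝔤 ι I₀ I₁ : Type*} [LieRing 𝔤] [LieAlgebra ℝ 𝔤]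

/-! ### Parities -/

section Parity

variable {K : Fin 4 → LocalAlg ι I₀ I₁}

lemma isOdd_fieldC (ρ : Fin 4) : IsOdd (fieldC ρ : LocalAlg ι I₀ I₁) := isOdd_oddCoord _

lemma isOdd_fieldCbar (ρ : Fin 4) : IsOdd (fieldCbar ρ : LocalAlg ι I₀ I₁) := isOdd_oddCoord _

lemma isOdd_fieldc (a : ι) : IsOdd (fieldc a : LocalAlg ι I₀ I₁) := isOdd_oddCoord _

lemma isOdd_fieldcbar (a : ι) : IsOdd (fieldcbar a : LocalAlg ι I₀ I₁) := isOdd_oddCoord _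

lemma isEven_fieldB (ρ : Fin 4) : IsEven (fieldB ρ : LocalAlg ι I₀ I₁) := isEven_evenCoord _

lemma isEven_fieldb (a : ι) : IsEven (fieldb a : LocalAlg ι I₀ I₁) := isEven_evenCoord _

lemma isEven_fieldA (a : ι) (μ : Fin 4) : IsEven (fieldA a μ : LocalAlg ι I₀ I₁) :=
  isEven_evenCoord _

lemma isEven_met (μ ν : Fin 4) : IsEven (met μ ν : LocalAlg ι I₀ I₁) := isEven_evenCoord _

lemma isOdd_lieScalar (hK : ∀ ρ, IsOdd (K ρ)) {φ : LocalAlg ι I₀ I₁} (hφ : IsEven φ) :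
    IsOdd (lieScalar K φ) :=
  TwistedCentral.sum fun ρ => (hK ρ).mul_even (hφ.totalD ρ)

lemma isEven_lieScalar (hK : ∀ ρ, IsOdd (K ρ)) {φ : LocalAlg ι I₀ I₁} (hφ : IsOdd φ) :
    IsEven (lieScalar K φ) :=
  TwistedCentral.sum fun ρ => (hK ρ).mul_odd (hφ.totalD ρ)

lemma isOdd_lieCovector (hK : ∀ ρ, IsOdd (K ρ)) {A : Fin 4 → LocalAlg ι I₀ I₁}
    (hA : ∀ μ, IsEven (A μ)) (μ : Fin 4) : IsOdd (lieCovector K A μ) :=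
  TwistedCentral.sum fun ρ => ((hK ρ).mul_even ((hA μ).totalD ρ)).add
    (((hK ρ).totalD μ).mul_even (hA ρ))

lemma isOdd_lieMetricSym (hK : ∀ ρ, IsOdd (K ρ)) (p : Sym2 (Fin 4)) : IsOdd (lieMetricSym K p) := by
  induction p using Sym2.ind with
  | _ μ ν =>
    change IsOdd (lieMetric K μ ν)
    exact TwistedCentral.sum fun ρ => (((hK ρ).mul_even ((isEven_met μ ν).totalD ρ)).add
      (((hK ρ).totalD μ).mul_even (isEven_met ρ ν))).add
      (((hK ρ).totalD ν).mul_even (isEven_met μ ρ))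

lemma isOdd_lieMatter {I : Type*} [Fintype I] (M : Multiplet 𝔤 I) (hK : ∀ ρ, IsOdd (K ρ))
    {φ : I → LocalAlg ι I₀ I₁} (hφ : ∀ i, IsEven (φ i)) (i : I) : IsOdd (lieMatter M K φ i) :=
  (isOdd_lieScalar hK (hφ i)).sub (TwistedCentral.sum fun μ => TwistedCentral.sum fun ν =>
    TwistedCentral.sum fun j => (((hK μ).totalD ν).mul_even (hφ j)).smul _)

lemma isEven_lieMatter {I : Type*} [Fintype I] (M : Multiplet 𝔤 I) (hK : ∀ ρ, IsOdd (K ρ))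
    {φ : I → LocalAlg ι I₀ I₁} (hφ : ∀ i, IsOdd (φ i)) (i : I) : IsEven (lieMatter M K φ i) :=
  (isEven_lieScalar hK (hφ i)).sub (TwistedCentral.sum fun μ => TwistedCentral.sum fun ν =>
    TwistedCentral.sum fun j => (((hK μ).totalD ν).mul_odd (hφ j)).smul _)

variable [Fintype ι]

lemma isOdd_gaugeMatter {I : Type*} [Fintype I] (M : Multiplet 𝔤 I) (e : Module.Basis ι ℝ 𝔤)
    {k : ι → LocalAlg ι I₀ I₁} (hk : ∀ a, IsOdd (k a)) {φ : I → LocalAlg ι I₀ I₁}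
    (hφ : ∀ i, IsEven (φ i)) (i : I) : IsOdd (gaugeMatter M e k φ i) :=
  TwistedCentral.sum fun a => TwistedCentral.sum fun j => ((hk a).mul_even (hφ j)).smul _

lemma isEven_gaugeMatter {I : Type*} [Fintype I] (M : Multiplet 𝔤 I) (e : Module.Basis ι ℝ 𝔤)
    {k : ι → LocalAlg ι I₀ I₁} (hk : ∀ a, IsOdd (k a)) {φ : I → LocalAlg ι I₀ I₁}
    (hφ : ∀ i, IsOdd (φ i)) (i : I) : IsEven (gaugeMatter M e k φ i) :=
  TwistedCentral.sum fun a => TwistedCentral.sum fun j => ((hk a).mul_odd (hφ j)).smul _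

lemma isOdd_colorBracket (e : Module.Basis ι ℝ 𝔤) {x y : ι → LocalAlg ι I₀ I₁}
    (hx : ∀ a, IsOdd (x a)) (hy : ∀ a, IsEven (y a)) (a : ι) : IsOdd (colorBracket e x y a) :=
  TwistedCentral.sum fun b => TwistedCentral.sum fun c => ((hx b).mul_even (hy c)).smul _

lemma isEven_colorBracket (e : Module.Basis ι ℝ 𝔤) {x y : ι → LocalAlg ι I₀ I₁}
    (hx : ∀ a, IsOdd (x a)) (hy : ∀ a, IsOdd (y a)) (a : ι) : IsEven (colorBracket e x y a) :=
  TwistedCentral.sum fun b => TwistedCentral.sum fun c => ((hx b).mul_odd (hy c)).smul _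

end Parity

/-! ### The BRST operators are odd derivations commuting with the total derivatives -/

/-- An odd derivation that commutes with the total derivatives. -/
structure IsEvolutionary (R : LocalAlg ι I₀ I₁ → LocalAlg ι I₀ I₁) : Prop where
  der : IsTwistedDer gradeInv R
  map_totalD : ∀ μ X, R (totalD μ X) = totalD μ (R X)

lemma isEvolutionary_prolong {p : EvenField ι I₀ → LocalAlg ι I₀ I₁}
    {q : OddField ι I₁ → LocalAlg ι I₀ I₁} (hp : ∀ u, IsOdd (p u)) (hq : ∀ θ, IsEven (q θ)) :
    IsEvolutionary (prolong p q) :=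
  ⟨isTwistedDer_prolong hp hq, prolong_totalD hp hq⟩

lemma gradeInv_fieldcbar (a : ι) : gradeInv (fieldcbar a : LocalAlg ι I₀ I₁) = -fieldcbar a :=
  gradeInv_oddCoord _

/-! ### The Yang–Mills boson as scalar times volume -/

section YangMills

variable [Fintype ι]

/-- The scalar factor `δ_{ab} g^{μν} A^a_μ A^b_ν - c̄_a c^a` of the Yang–Mills gauge fixing boson. -/
noncomputable def bosonGScalar : LocalAlg ι I₀ I₁ :=
  ∑ a, ∑ μ, ∑ ν, metInv μ ν * fieldA a μ * fieldA a ν - ∑ a, fieldcbar a * fieldc a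

lemma bosonG_eq (ξ : ℝ) : (bosonG ξ : LocalAlg ι I₀ I₁) = (-(ξ / 2)) • (bosonGScalar * volg) := rfl

lemma IsDiffeoOp.isScalar_bosonGScalar {ϰ : ℝ} {K : Fin 4 → LocalAlg ι I₀ I₁}
    {R : LocalAlg ι I₀ I₁ → LocalAlg ι I₀ I₁} (h : IsDiffeoOp ϰ K R)
    (hA : ∀ a, IsCovector ϰ K R (fieldA a)) (hc : ∀ a, IsScalar ϰ K R (fieldc a))
    (hcbar : ∀ a, IsScalar ϰ K R (fieldcbar a)) : IsScalar ϰ K R bosonGScalar :=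
  h.isScalar_sub (h.isScalar_sum fun a => h.isScalar_contraction (hA a) (hA a))
    (h.isScalar_sum fun a => h.isScalar_mul (hcbar a) (hc a))

lemma IsDiffeoOp.isScalar_colorBracket {ϰ : ℝ} (e : Module.Basis ι ℝ 𝔤) {K : Fin 4 → LocalAlg ι I₀ I₁}
    {R : LocalAlg ι I₀ I₁ → LocalAlg ι I₀ I₁} (h : IsDiffeoOp ϰ K R)
    {x y : ι → LocalAlg ι I₀ I₁} (hx : ∀ a, IsScalar ϰ K R (x a)) (hy : ∀ a, IsScalar ϰ K R (y a))
    (a : ι) : IsScalar ϰ K R (colorBracket e x y a) :=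
  h.isScalar_sum fun b => h.isScalar_sum fun c =>
    h.isScalar_smul _ (h.isScalar_mul (hx b) (hy c))

end YangMills

section Operators

variable [Fintype I₀] [Fintype I₁] (ϰ ζ γ ξ : ℝ) (e : Module.Basis ι ℝ 𝔤) (M₀ : Multiplet 𝔤 I₀)
  (M₁ : Multiplet 𝔤 I₁)

lemma isEvolutionary_opP :
    IsEvolutionary (opP ϰ ζ M₀ M₁ : LocalAlg ι I₀ I₁ → LocalAlg ι I₀ I₁) := by
  refine isEvolutionary_prolong (fun u => ?_) (fun θ => ?_)
  · cases u with
    | metric p => exact (isOdd_lieMetricSym isOdd_fieldC p).smul _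
    | auxB ρ => exact .zero
    | gauge a μ => exact (isOdd_lieCovector isOdd_fieldC (isEven_fieldA a) μ).smul _
    | auxb a => exact (isOdd_lieScalar isOdd_fieldC (isEven_fieldb a)).smul _
    | matter i => exact (isOdd_lieMatter M₀ isOdd_fieldC (fun _ => isEven_evenCoord _) i).smul _
  · cases θ with
    -- The sum $C^\sigma\partial_\sigma C^\rho$ is definitionally `lieScalar` applied to the single
    -- component $C^\rho$.
    | ghostC ρ => exact (isEven_lieScalar isOdd_fieldC (isOdd_fieldC ρ)).smul _
    | antighostC ρ => exact (isEven_fieldB ρ).smul _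
    | ghostc a => exact (isEven_lieScalar isOdd_fieldC (isOdd_fieldc a)).smul _
    | antighostc a => exact (isEven_lieScalar isOdd_fieldC (isOdd_fieldcbar a)).smul _
    | matter i => exact (isEven_lieMatter M₁ isOdd_fieldC (fun _ => isOdd_oddCoord _) i).smul _

lemma isEvolutionary_opPbar :
    IsEvolutionary (opPbar ϰ ζ M₀ M₁ : LocalAlg ι I₀ I₁ → LocalAlg ι I₀ I₁) := by
  refine isEvolutionary_prolong (fun u => ?_) (fun θ => ?_)
  · cases u with
    | metric p => exact (isOdd_lieMetricSym isOdd_fieldCbar p).smul _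
    | auxB ρ =>
      exact (TwistedCentral.sum fun σ =>
        ((isOdd_fieldCbar σ).mul_even ((isEven_fieldB ρ).totalD σ)).sub
        (((isOdd_fieldCbar ρ).totalD σ).mul_even (isEven_fieldB σ))).smul _
    | gauge a μ => exact (isOdd_lieCovector isOdd_fieldCbar (isEven_fieldA a) μ).smul _
    | auxb a => exact (isOdd_lieScalar isOdd_fieldCbar (isEven_fieldb a)).smul _
    | matter i => exact (isOdd_lieMatter M₀ isOdd_fieldCbar (fun _ => isEven_evenCoord _) i).smul _
  · cases θ with
    | ghostC ρ =>
      exact ((isEven_fieldB ρ).smul _).neg.add ((TwistedCentral.sum fun σ =>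
        ((isOdd_fieldCbar σ).mul_odd ((isOdd_fieldC ρ).totalD σ)).sub
        (((isOdd_fieldCbar ρ).totalD σ).mul_odd (isOdd_fieldC σ))).smul _)
    | antighostC ρ => exact (isEven_lieScalar isOdd_fieldCbar (isOdd_fieldCbar ρ)).smul _
    | ghostc a => exact (isEven_lieScalar isOdd_fieldCbar (isOdd_fieldc a)).smul _
    | antighostc a => exact (isEven_lieScalar isOdd_fieldCbar (isOdd_fieldcbar a)).smul _
    | matter i => exact (isEven_lieMatter M₁ isOdd_fieldCbar (fun _ => isOdd_oddCoord _) i).smul _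

lemma isDiffeoOp_opP : IsDiffeoOp ϰ (fieldC : Fin 4 → LocalAlg ι I₀ I₁) (opP ϰ ζ M₀ M₁) where
  der := (isEvolutionary_opP ϰ ζ M₀ M₁).der
  map_totalD := (isEvolutionary_opP ϰ ζ M₀ M₁).map_totalD
  odd := isOdd_fieldC
  map_met _ _ := prolong_evenCoord _

lemma isDiffeoOp_opPbar :
    IsDiffeoOp ϰ (fieldCbar : Fin 4 → LocalAlg ι I₀ I₁) (opPbar ϰ ζ M₀ M₁) where
  der := (isEvolutionary_opPbar ϰ ζ M₀ M₁).der
  map_totalD := (isEvolutionary_opPbar ϰ ζ M₀ M₁).map_totalD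
  odd := isOdd_fieldCbar
  map_met _ _ := prolong_evenCoord _

variable [Fintype ι]

lemma isEvolutionary_opQ :
    IsEvolutionary (opQ γ ξ e M₀ M₁ : LocalAlg ι I₀ I₁ → LocalAlg ι I₀ I₁) := by
  refine isEvolutionary_prolong (fun u => ?_) (fun θ => ?_)
  · cases u with
    | metric p => exact .zero
    | auxB ρ => exact .zero
    | gauge a μ =>
      exact (((isOdd_fieldc a).totalD μ).smul _).add
        ((isOdd_colorBracket e isOdd_fieldc (fun c => isEven_fieldA c μ) a).smul _)
    | auxb a => exact .zero
    | matter i => exact (isOdd_gaugeMatter M₀ e isOdd_fieldc (fun _ => isEven_evenCoord _) i).smul _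
  · cases θ with
    | ghostC ρ => exact .zero
    | antighostC ρ => exact .zero
    | ghostc a => exact (isEven_colorBracket e isOdd_fieldc isOdd_fieldc a).smul _
    | antighostc a => exact (isEven_fieldb a).smul _
    | matter i => exact (isEven_gaugeMatter M₁ e isOdd_fieldc (fun _ => isOdd_oddCoord _) i).smul _

lemma isEvolutionary_opQbar :
    IsEvolutionary (opQbar γ ξ e M₀ M₁ : LocalAlg ι I₀ I₁ → LocalAlg ι I₀ I₁) := by
  refine isEvolutionary_prolong (fun u => ?_) (fun θ => ?_)
  · cases u with
    | metric p => exact .zero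
    | auxB ρ => exact .zero
    | gauge a μ =>
      exact (((isOdd_fieldcbar a).totalD μ).smul _).add
        ((isOdd_colorBracket e isOdd_fieldcbar (fun c => isEven_fieldA c μ) a).smul _)
    | auxb a => exact (isOdd_colorBracket e isOdd_fieldcbar isEven_fieldb a).smul _
    | matter i =>
      exact (isOdd_gaugeMatter M₀ e isOdd_fieldcbar (fun _ => isEven_evenCoord _) i).smul _
  · cases θ with
    | ghostC ρ => exact .zero
    | antighostC ρ => exact .zero
    | ghostc a =>
      exact ((isEven_fieldb a).smul _).neg.add
        ((isEven_colorBracket e isOdd_fieldcbar isOdd_fieldc a).smul _)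
    | antighostc a => exact (isEven_colorBracket e isOdd_fieldcbar isOdd_fieldcbar a).smul _
    | matter i =>
      exact (isEven_gaugeMatter M₁ e isOdd_fieldcbar (fun _ => isOdd_oddCoord _) i).smul _

/-! ### Diffeomorphism operators on the Yang–Mills gauge fixing boson -/

lemma opQbar_met (μ ν : Fin 4) : opQbar γ ξ e M₀ M₁ (met μ ν : LocalAlg ι I₀ I₁) = 0 :=
  prolong_evenCoord _

/-- An operator that annihilates the metric is the case $\Lambda=0$ of a metric action. -/
lemma opQbar_metInv (μ ν : Fin 4) : opQbar γ ξ e M₀ M₁ (metInv μ ν : LocalAlg ι I₀ I₁) = 0 := by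
  have h := map_metInv_of_metricAction (Λ := fun _ _ => 0) (isEvolutionary_opQbar γ ξ e M₀ M₁).der
    (fun μ ν => by simp [opQbar_met]) μ ν
  simpa using h

lemma opQbar_volg : opQbar γ ξ e M₀ M₁ (volg : LocalAlg ι I₀ I₁) = 0 := by
  have h := map_volg_of_metricAction (Λ := fun _ _ => 0) (isEvolutionary_opQbar γ ξ e M₀ M₁).der
    (fun μ ν => by simp [opQbar_met])
  simpa using h

lemma opQbar_bosonGScalar : opQbar γ ξ e M₀ M₁ (bosonGScalar : LocalAlg ι I₀ I₁) =
    ∑ a, (∑ μ, ∑ ν, metInv μ ν * opQbar γ ξ e M₀ M₁ (fieldA a μ) * fieldA a ν +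
      ∑ μ, ∑ ν, metInv μ ν * fieldA a μ * opQbar γ ξ e M₀ M₁ (fieldA a ν)) -
    ∑ a, (opQbar γ ξ e M₀ M₁ (fieldcbar a) * fieldc a -
      fieldcbar a * opQbar γ ξ e M₀ M₁ (fieldc a)) := by
  have hQ := (isEvolutionary_opQbar (ι := ι) (I₀ := I₀) (I₁ := I₁) γ ξ e M₀ M₁).der
  have hinv : ∀ μ ν, gradeInv (metInv μ ν : LocalAlg ι I₀ I₁) = metInv μ ν :=
    fun μ ν => gradeInv_ofEven _
  have hA : ∀ a μ, gradeInv (fieldA a μ : LocalAlg ι I₀ I₁) = fieldA a μ :=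
    fun a μ => gradeInv_evenCoord _
  simp only [bosonGScalar, hQ.sub, hQ.sum, hQ.leibniz, opQbar_metInv, map_mul, hinv, hA,
    gradeInv_fieldcbar, zero_mul, zero_add, Finset.sum_add_distrib, neg_mul, ← sub_eq_add_neg]

/-- $\overline Q$ respects tensor type under $P$: $\overline QA$ is a gradient of a scalar plus
scalars times covectors, while $\overline Qc$ and $\overline Q\,\overline c$ are built from scalars.
This rests on $P$ acting on $\overline c$ and $b$ by the Lie derivative. -/
lemma isScalar_opQbar_bosonGScalar :
    IsScalar ϰ fieldC (opP ϰ ζ M₀ M₁) (opQbar γ ξ e M₀ M₁ (bosonGScalar : LocalAlg ι I₀ I₁)) := by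
  have h := isDiffeoOp_opP (ι := ι) ϰ ζ M₀ M₁
  have hA : ∀ a, IsCovector ϰ fieldC (opP ϰ ζ M₀ M₁) (fieldA a : Fin 4 → LocalAlg ι I₀ I₁) :=
    fun a μ => prolong_evenCoord _
  have hc : ∀ a, IsScalar ϰ fieldC (opP ϰ ζ M₀ M₁) (fieldc a : LocalAlg ι I₀ I₁) :=
    fun a => prolong_oddCoord _
  have hcbar : ∀ a, IsScalar ϰ fieldC (opP ϰ ζ M₀ M₁) (fieldcbar a : LocalAlg ι I₀ I₁) :=
    fun a => prolong_oddCoord _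
  have hb : ∀ a, IsScalar ϰ fieldC (opP ϰ ζ M₀ M₁) (fieldb a : LocalAlg ι I₀ I₁) :=
    fun a => prolong_evenCoord _
  have hQA : ∀ a, IsCovector ϰ fieldC (opP ϰ ζ M₀ M₁)
      fun μ => opQbar γ ξ e M₀ M₁ (fieldA a μ : LocalAlg ι I₀ I₁) := fun a => by
    rw [show (fun μ => opQbar γ ξ e M₀ M₁ (fieldA a μ : LocalAlg ι I₀ I₁)) =
      fun μ => (1 / ξ) • totalD μ (fieldcbar a) +
        γ • colorBracket e fieldcbar (fun c => fieldA c μ) a from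
      funext fun μ => prolong_evenCoord _]
    exact h.isCovector_add (h.isCovector_smul _ (h.isCovector_totalD (hcbar a)))
      (h.isCovector_smul _ (h.isCovector_sum fun b => h.isCovector_sum fun c =>
        h.isCovector_smul _ (h.isCovector_mul (hcbar b) (hA c))))
  have hQcbar : ∀ a, IsScalar ϰ fieldC (opP ϰ ζ M₀ M₁)
      (opQbar γ ξ e M₀ M₁ (fieldcbar a : LocalAlg ι I₀ I₁)) := fun a => by
    rw [show opQbar γ ξ e M₀ M₁ (fieldcbar a : LocalAlg ι I₀ I₁) =
      (γ / 2) • colorBracket e fieldcbar fieldcbar a from prolong_oddCoord _]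
    exact h.isScalar_smul _ (h.isScalar_colorBracket e hcbar hcbar a)
  have hQc : ∀ a, IsScalar ϰ fieldC (opP ϰ ζ M₀ M₁)
      (opQbar γ ξ e M₀ M₁ (fieldc a : LocalAlg ι I₀ I₁)) := fun a => by
    rw [show opQbar γ ξ e M₀ M₁ (fieldc a : LocalAlg ι I₀ I₁) =
      -((1 / ξ) • fieldb a) + γ • colorBracket e fieldcbar fieldc a from prolong_oddCoord _]
    exact h.isScalar_add (h.isScalar_neg (h.isScalar_smul _ (hb a)))
      (h.isScalar_smul _ (h.isScalar_colorBracket e hcbar hc a))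
  rw [opQbar_bosonGScalar]
  exact h.isScalar_sub
    (h.isScalar_sum fun a => h.isScalar_add (h.isScalar_contraction (hQA a) (hA a))
      (h.isScalar_contraction (hA a) (hQA a)))
    (h.isScalar_sum fun a => h.isScalar_sub (h.isScalar_mul (hQcbar a) (hc a))
      (h.isScalar_mul (hcbar a) (hQc a)))

lemma opPbar_bosonG : opPbar ϰ ζ M₀ M₁ (bosonG ξ : LocalAlg ι I₀ I₁) =
    ∑ ρ, totalD ρ ((-(ξ / 2)) • ϰ • (fieldCbar ρ * (bosonGScalar * volg))) := by
  have h := isDiffeoOp_opPbar (ι := ι) ϰ ζ M₀ M₁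
  have hS : IsScalar ϰ fieldCbar (opPbar ϰ ζ M₀ M₁) (bosonGScalar : LocalAlg ι I₀ I₁) :=
    h.isScalar_bosonGScalar (fun a μ => prolong_evenCoord _) (fun a => prolong_oddCoord _)
      (fun a => prolong_oddCoord _)
  rw [bosonG_eq, h.der.smul, h.map_mul_volg hS, Finset.smul_sum]
  simp only [(isTwistedDer_totalD _).smul]

lemma opP_opQbar_bosonG : opP ϰ ζ M₀ M₁ (opQbar γ ξ e M₀ M₁ (bosonG ξ : LocalAlg ι I₀ I₁)) =
    ∑ ρ, totalD ρ ((-(ξ / 2)) • ϰ •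
      (fieldC ρ * (opQbar γ ξ e M₀ M₁ bosonGScalar * volg))) := by
  have h := isDiffeoOp_opP (ι := ι) ϰ ζ M₀ M₁
  have hQ := (isEvolutionary_opQbar (ι := ι) (I₀ := I₀) (I₁ := I₁) γ ξ e M₀ M₁).der
  rw [bosonG_eq, hQ.smul, hQ.leibniz, opQbar_volg, mul_zero, add_zero, h.der.smul,
    h.map_mul_volg (isScalar_opQbar_bosonGScalar ϰ ζ γ ξ e M₀ M₁), Finset.smul_sum]
  simp only [(isTwistedDer_totalD _).smul]

/-! ### Gauge operators on the gravitational gauge fixing boson -/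

lemma opQbar_bosonF (α : ℝ) :
    opQbar γ ξ e M₀ M₁ (bosonF ϰ ζ α : LocalAlg ι I₀ I₁) = 0 := by
  have hQ := (isEvolutionary_opQbar (ι := ι) (I₀ := I₀) (I₁ := I₁) γ ξ e M₀ M₁).der
  have hC : ∀ ρ, opQbar γ ξ e M₀ M₁ (fieldC ρ : LocalAlg ι I₀ I₁) = 0 :=
    fun ρ => prolong_oddCoord _
  have hCbar : ∀ ρ, opQbar γ ξ e M₀ M₁ (fieldCbar ρ : LocalAlg ι I₀ I₁) = 0 :=
    fun ρ => prolong_oddCoord _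
  simp only [bosonF, graviton, hQ.smul, hQ.sub, hQ.sum, hQ.leibniz, opQbar_met, hQ.map_algebraMap,
    hC, hCbar, mul_zero, zero_mul, add_zero, sub_zero, smul_zero, Finset.sum_const_zero]

/-- $\overline P$ keeps $F$ inside the gravitational sector: only $g$, $C$, $\overline C$, $B$ and
their derivatives occur, and $Q$, which commutes with $\partial_\mu$, annihilates them all. -/
lemma opQ_opPbar_bosonF (α : ℝ) :
    opQ γ ξ e M₀ M₁ (opPbar ϰ ζ M₀ M₁ (bosonF ϰ ζ α : LocalAlg ι I₀ I₁)) = 0 := by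
  have hQ := (isEvolutionary_opQ (ι := ι) (I₀ := I₀) (I₁ := I₁) γ ξ e M₀ M₁).der
  have hQD := (isEvolutionary_opQ (ι := ι) (I₀ := I₀) (I₁ := I₁) γ ξ e M₀ M₁).map_totalD
  have hP := (isEvolutionary_opPbar (ι := ι) (I₀ := I₀) (I₁ := I₁) ϰ ζ M₀ M₁).der
  have hC : ∀ ρ, opQ γ ξ e M₀ M₁ (fieldC ρ : LocalAlg ι I₀ I₁) = 0 :=
    fun ρ => prolong_oddCoord _
  have hCbar : ∀ ρ, opQ γ ξ e M₀ M₁ (fieldCbar ρ : LocalAlg ι I₀ I₁) = 0 :=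
    fun ρ => prolong_oddCoord _
  have hB : ∀ ρ, opQ γ ξ e M₀ M₁ (fieldB ρ : LocalAlg ι I₀ I₁) = 0 :=
    fun ρ => prolong_evenCoord _
  have hmet : ∀ μ ν, opQ γ ξ e M₀ M₁ (met μ ν : LocalAlg ι I₀ I₁) = 0 :=
    fun μ ν => prolong_evenCoord _
  have hσ : ∀ ρ, gradeInv (fieldCbar ρ : LocalAlg ι I₀ I₁) = -fieldCbar ρ :=
    fun ρ => gradeInv_oddCoord _
  have hPC : ∀ ρ, opPbar ϰ ζ M₀ M₁ (fieldC ρ : LocalAlg ι I₀ I₁) = -((1 / ζ) • fieldB ρ) +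
      ϰ • ∑ σ, (fieldCbar σ * totalD σ (fieldC ρ) - totalD σ (fieldCbar ρ) * fieldC σ) :=
    fun ρ => prolong_oddCoord _
  have hPCbar : ∀ ρ, opPbar ϰ ζ M₀ M₁ (fieldCbar ρ : LocalAlg ι I₀ I₁) =
      ϰ • ∑ σ, fieldCbar σ * totalD σ (fieldCbar ρ) := fun ρ => prolong_oddCoord _
  have hD : ∀ μ, totalD μ (0 : LocalAlg ι I₀ I₁) = 0 := fun μ => (isTwistedDer_totalD μ).zero
  simp only [bosonF, graviton, hP.smul, hP.sub, hP.sum, hP.leibniz, hP.map_algebraMap, hPC, hPCbar,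
    (isDiffeoOp_opPbar ϰ ζ M₀ M₁).map_met, lieMetric, hσ]
  simp only [hQ.smul, hQ.sub, hQ.add, hQ.neg, hQ.sum, hQ.leibniz, hQD, hC, hCbar, hB, hmet,
    hD, mul_zero, zero_mul, add_zero, sub_zero, neg_zero, smul_zero, Finset.sum_const_zero]

end Operators

end BRST

/-! ### Assembling the mixed terms -/

theorem mainTheorem3 {𝔤 ι I₀ I₁ : Type*} [LieRing 𝔤] [LieAlgebra ℝ 𝔤] [Fintype ι]
    [Fintype I₀] [Fintype I₁]
    (e : Module.Basis ι ℝ 𝔤) (M₀ : BRST.Multiplet 𝔤 I₀) (M₁ : BRST.Multiplet 𝔤 I₁)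
    (ϰ ζ γ ξ α : ℝ) (hϰ : ϰ ≠ 0) (hζ : ζ ≠ 0) (hξ : ξ ≠ 0) (hα : α ≠ 0) :
    BRST.EqModTD
      (BRST.grGFGhost ϰ ζ α M₀ M₁ + BRST.ymGFGhost γ ξ e M₀ M₁ : BRST.LocalAlg ι I₀ I₁)
      (BRST.superD ϰ ζ γ ξ e M₀ M₁ (BRST.bosonB ϰ ζ ξ α)) := by
  open BRST in
  have hP := isEvolutionary_opP (ι := ι) (I₀ := I₀) (I₁ := I₁) ϰ ζ M₀ M₁
  have hPbar := isEvolutionary_opPbar (ι := ι) (I₀ := I₀) (I₁ := I₁) ϰ ζ M₀ M₁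
  have hQ := isEvolutionary_opQ (ι := ι) (I₀ := I₀) (I₁ := I₁) γ ξ e M₀ M₁
  have hQbar := isEvolutionary_opQbar (ι := ι) (I₀ := I₀) (I₁ := I₁) γ ξ e M₀ M₁
  let X (ρ : Fin 4) : LocalAlg ι I₀ I₁ :=
    (-(ξ / 2)) • ϰ • (fieldCbar ρ * (bosonGScalar * volg))
  let Y (ρ : Fin 4) : LocalAlg ι I₀ I₁ :=
    (-(ξ / 2)) • ϰ • (fieldC ρ * (opQbar γ ξ e M₀ M₁ bosonGScalar * volg))
  -- With $\overline PG=\partial_\rho X^\rho$ and $P\overline QG=\partial_\rho Y^\rho$, the three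
  -- summands account for $P\overline PG$, $Q\overline PG$ and $P\overline QG$. The minus sign
  -- appears because these terms belong to the subtracted side.
  refine ⟨fun ρ => -(opP ϰ ζ M₀ M₁ (X ρ) + opQ γ ξ e M₀ M₁ (X ρ) + Y ρ), ?_⟩
  have hX : opPbar ϰ ζ M₀ M₁ (bosonG ξ) = ∑ ρ, totalD ρ (X ρ) := opPbar_bosonG ϰ ζ ξ M₀ M₁
  have hY : opP ϰ ζ M₀ M₁ (opQbar γ ξ e M₀ M₁ (bosonG ξ)) = ∑ ρ, totalD ρ (Y ρ) :=
    opP_opQbar_bosonG ϰ ζ γ ξ e M₀ M₁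
  simp only [grGFGhost, ymGFGhost, superP, superQ, superD, opD, opDbar, bosonB, Function.comp_apply,
    Pi.add_apply, hPbar.der.add, hQbar.der.add, hP.der.add, hQ.der.add, opQbar_bosonF,
    opQ_opPbar_bosonF, hP.der.zero, hQ.der.zero, hX, hY, hP.der.sum, hQ.der.sum, hP.map_totalD,
    hQ.map_totalD, (isTwistedDer_totalD _).neg, (isTwistedDer_totalD _).add,
    Finset.sum_neg_distrib, Finset.sum_add_distrib]
  abel
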